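/- Let $N$ be a nonnegative integer and let $\mathcal A=\{1,\dots,N\}\sqcup\{\bar 1,\dots,\bar N\}$ be the alphabet of unbarred and barred letters, with the natural order $1<\bar 1<2<\bar 2<\cdots<N<\bar N$. For $x\in\mathcal A$ let $x{\Downarrow}$ be the letter immediately below $x$ in this order, that is $a{\Downarrow}=\overline{a-1}$ for $2\le a\le N$ and $\bar a{\Downarrow}=a$ for $1\le a\le N$ ($1{\Downarrow}$ is undefined; relations below involving an undefined letter are omitted). Let $\mathcal U$ be the free associative $\mathbb Z$-algebra on noncommuting variables $u_x$, $x\in\mathcal A$; a word $w_1\cdots w_t$ in $\mathcal A$ is identified with the monomial $u_{w_1}\cdots u_{w_t}$. Let $I_{\mathrm{kron}}$ be the two-sided ideal of $\mathcal U$ corresponding to the relations $$\begin{aligned} yyx&=yxy && (x\in\mathcal A,\ y \text{ unbarred},\ x<y),\\ zyy&=yzy && (z\in\mathcal A,\ y \text{ unbarred},\ y<z),\\ yyz&=yzy && (z\in\mathcal A,\ y \text{ barred},\ y<z),\\ xyy&=yxy && (x\in\mathcal A,\ y \text{ barred},\ x<y),\\ (xz-zx)y&=y(xz-zx) && (x,y,z\in\mathcal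 A,\ x=y{\Downarrow}=z{\Downarrow}{\Downarrow}),\\ xz&=zx && (x,z\in\mathcal A,\ x<z{\Downarrow}{\Downarrow}). \end{aligned}$$ For letters $x,y$ write $y\gtrdot x$ if $y>x$, or if $y$ and $x$ are equal barred letters. For $k\ge 1$ let $$e_k(\mathbf u)=\sum_{z_1\gtrdot z_2\gtrdot\cdots\gtrdot z_k} u_{z_1}u_{z_2}\cdots u_{z_k}\in\mathcal U,$$ and set $e_0(\mathbf u)=1$ and $e_k(\mathbf u)=0$ for $k<0$. For a partition $\nu$ with conjugate $\nu'=(\nu'_1,\dots,\nu'_t)$, $t=\nu_1$, the noncommutative super Schur function is $$\mathfrak J_\nu(\mathbf u)=\sum_{\pi\in S_t}\operatorname{sgn}(\pi)\,e_{\nu'_1+\pi(1)-1}(\mathbf u)\,e_{\nu'_2+\pi(2)-2}(\mathbf u)\cdots e_{\nu'_t+\pi(t)-t}(\mathbf u)\in\mathcal U .$$ A $<$-colored tableau of shape $\nu$ is a filling of the Young diagram of $\nu$ (drawn with the English convention) by letters of $\mathcal A$ whose rows and columns are weakly increasing for $<$, and such that the unbarred letters in each column and the barred letters in each row are strictly increasing.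 Let $\mathrm{CT}^<_\nu$ be the set of these tableaux. For $T\in \mathrm{CT}^<_\nu$ let $D^1,\dots,D^k$ be the diagonals of $T$ (the sets of boxes with a fixed value of column index minus row index), starting from the southwest; let $w^i$ be the word obtained by reading the unbarred entries of $D^i$ from southeast to northwest, followed by the barred entries of $D^i$ from northwest to southeast; and let $\mathrm{sqread}(T)=w^1w^2\cdots w^k$. **Theorem.** For every partition $\nu$, $$\mathfrak J_\nu(\mathbf u)=\sum_{T\in \mathrm{CT}^<_\nu}\mathrm{sqread}(T)\qquad\text{in } \mathcal U/I_{\mathrm{kron}} .$$ -/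

import Mathlib

namespace SuperSchur

/-- The alphabet of unbarred letters `1, …, N` and barred letters `1̄, …, N̄`. The letter `a` is
`toLex (a - 1, false)` and the barred letter `ā` is `toLex (a - 1, true)`, so that the
lexicographic order is the natural order `1 < 1̄ < 2 < 2̄ < ⋯ < N < N̄`. -/
abbrev Letter (N : ℕ) : Type := Fin N ×ₗ Bool

/-- The unbarred letter with (zero-based) index `a`. -/
def unbar {N : ℕ} (a : Fin N) : Letter N := toLex (a, false)

/-- The barred letter with (zero-based) index `a`. -/
def bar {N : ℕ} (a : Fin N) : Letter N := toLex (a, true)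

/-- A letter is barred. -/
def Barred {N : ℕ} (x : Letter N) : Prop := (ofLex x).2 = true

instance {N : ℕ} : DecidablePred (Barred (N := N)) :=
  fun x => inferInstanceAs (Decidable ((ofLex x).2 = true))

/-- Going down by one in the natural order: `ā ↦ a`, and `a ↦` barred `a - 1` for `2 ≤ a`.
It is undefined (`none`) at the smallest letter `1`. -/
def down {N : ℕ} (x : Letter N) : Option (Letter N) :=
  if Barred x then some (unbar (ofLex x).1)
  else if 0 < (ofLex x).1.val then
    some (bar ⟨(ofLex x).1.val - 1, (Nat.sub_le _ _).trans_lt (ofLex x).1.isLt⟩)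
  else none

/-- Going down by two. -/
def downTwo {N : ℕ} (x : Letter N) : Option (Letter N) := (down x).bind down

/-- The free associative `ℤ`-algebra on the letters. -/
abbrev U (N : ℕ) : Type := FreeAlgebra ℤ (Letter N)

/-- The noncommuting variable attached to a letter. -/
def u {N : ℕ} (x : Letter N) : U N := FreeAlgebra.ι ℤ x

/-- The monomial attached to a colored word. -/
def monomial {N : ℕ} (w : List (Letter N)) : U N := (w.map u).prod

/-- The defining relations of the quotient `U / I_kron`. -/
inductive KronRel (N : ℕ) : U N → U N → Prop
  | yyx {x y : Letter N} (hy : ¬ Barred y) (hxy : x < y) :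
      KronRel N (u y * u y * u x) (u y * u x * u y)
  | zyy {y z : Letter N} (hy : ¬ Barred y) (hyz : y < z) :
      KronRel N (u z * u y * u y) (u y * u z * u y)
  | yyz {y z : Letter N} (hy : Barred y) (hyz : y < z) :
      KronRel N (u y * u y * u z) (u y * u z * u y)
  | xyy {x y : Letter N} (hy : Barred y) (hxy : x < y) :
      KronRel N (u x * u y * u y) (u y * u x * u y)
  | rotate {x y z : Letter N} (hy : down y = some x) (hz : downTwo z = some x) :
      KronRel N ((u x * u z - u z * u x) * u y) (u y * (u x * u z - u z * u x))
  | far {x z v : Letter N} (hz : downTwo z = some v) (hxv : x < v) :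
      KronRel N (u x * u z) (u z * u x)

/-- The quotient algebra `U / I_kron`. -/
abbrev UKron (N : ℕ) : Type := RingQuot (KronRel N)

/-- The canonical projection `U → U / I_kron`. -/
def toUKron (N : ℕ) : U N →+* UKron N := RingQuot.mkRingHom (KronRel N)

/-- `ColGE y x`: either `y > x`, or `y` and `x` are equal barred letters. -/
def ColGE {N : ℕ} (y x : Letter N) : Prop := x < y ∨ (y = x ∧ Barred y)

instance {N : ℕ} : DecidableRel (ColGE (N := N)) :=
  fun y x => inferInstanceAs (Decidable (x < y ∨ (y = x ∧ Barred y)))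

/-- The noncommutative super elementary symmetric function `e_k(u)` for an integer `k`: the sum of
all monomials `u_{z_1} ⋯ u_{z_k}` in which consecutive letters satisfy `ColGE` (only the empty
monomial `1` if `k = 0`), and zero if `k` is negative. -/
def elem (N : ℕ) : ℤ → U N
  | Int.ofNat k =>
      ∑ z : Fin k → Letter N with (List.ofFn z).IsChain ColGE, monomial (List.ofFn z)
  | Int.negSucc _ => 0

/-- The noncommutative super Schur function of the partition with Young diagram `ν`. Here
`ν.rowLen 0` is the number of columns, and `ν.colLen i` is the part of index `i` (zero-based) of the
conjugate partition. The product is taken in order, from left to right. -/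
noncomputable def superSchur (N : ℕ) (ν : YoungDiagram) : U N :=
  ∑ π : Equiv.Perm (Fin (ν.rowLen 0)),
    (Equiv.Perm.sign π : ℤ) •
      (List.ofFn fun i : Fin (ν.rowLen 0) =>
        elem N ((ν.colLen i : ℤ) + ((π i : ℕ) : ℤ) - ((i : ℕ) : ℤ))).prod

/-- A filling of the boxes of `ν` by letters is a `<`-colored tableau: rows and columns are weakly
increasing, the barred letters in each row and the unbarred letters in each column are strictly
increasing. The box `(i, j)` is in row `i` (counted downwards) and column `j`. -/
def IsColoredTableau {N : ℕ} {ν : YoungDiagram} (T : ν.cells → Letter N) : Prop :=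
  (∀ p q : ν.cells, p.1.1 = q.1.1 → p.1.2 < q.1.2 →
    T p ≤ T q ∧ (Barred (T p) → Barred (T q) → T p < T q)) ∧
  (∀ p q : ν.cells, p.1.2 = q.1.2 → p.1.1 < q.1.1 →
    T p ≤ T q ∧ (¬ Barred (T p) → ¬ Barred (T q) → T p < T q))

instance {N : ℕ} {ν : YoungDiagram} : DecidablePred (IsColoredTableau (N := N) (ν := ν)) :=
  fun _ => @instDecidableAnd _ _ inferInstance inferInstance

/-- The set `CT_ν^<` of `<`-colored tableaux of shape `ν`. -/
abbrev ColoredTableau (N : ℕ) (ν : YoungDiagram) : Type :=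
  {T : ν.cells → Letter N // IsColoredTableau T}

/-- The entries on the diagonal of all boxes `(i, j)` with `j - i = d`, from northwest to
southeast. -/
def diagonal {N : ℕ} {ν : YoungDiagram} (T : ν.cells → Letter N) (d : ℤ) : List (Letter N) :=
  (List.range (ν.colLen 0)).filterMap fun i : ℕ =>
    if h : 0 ≤ (i : ℤ) + d ∧ (i, ((i : ℤ) + d).toNat) ∈ ν.cells then some (T ⟨_, h.2⟩) else none

/-- The word of one diagonal: its unbarred entries from southeast to northwest, followed by its
barred entries from northwest to southeast. -/
def diagonalWord {N : ℕ} {ν : YoungDiagram} (T : ν.cells → Letter N) (d : ℤ) : List (Letter N) :=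
  ((diagonal T d).filter fun x => ¬ Barred x).reverse ++ (diagonal T d).filter fun x => Barred x

/-- The colored word `sqread(T)`: the concatenation of the words of the diagonals, starting with the
southwesternmost. The values of `d` run through all integers from `-(number of rows)` up to
`(number of columns) - 1`, in increasing order; diagonals without boxes contribute nothing. -/
def sqread {N : ℕ} {ν : YoungDiagram} (T : ν.cells → Letter N) : List (Letter N) :=
  (List.range (ν.colLen 0 + ν.rowLen 0)).flatMap fun k =>
    diagonalWord T ((k : ℤ) - (ν.colLen 0 : ℤ))

end SuperSchur

namespace SuperSchur

/-! Number the letters 0, 1, 2, … in the natural order, even ones unbarred. Put the determinant into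
an exterior algebra with coefficients in the quotient ring: column `c` of `ν` gives the element `∑
j, e_{ν'_c - c + j} ε_j`, called its row, and the ordered product of the rows is the noncommutative
determinant times the top form. The theorem follows by peeling boxes off this product, one diagonal
at a time from the southwest and, inside a diagonal, from southeast to northwest.

Each row carries a flag `m`: only letters below `2 * m` occur in it. Flags start at `N`; once a box
of column `c` has received the letter `d`, the flag of the remaining column is `(d + 1) / 2`, which
is the column condition on the next entry. Removing a box writes `e_k` as a smaller-flag `e_k` plus
a sum over its first letter `d`. The smaller flag is that of the column to the left, whose row then
has the same degree, so this term contains the square of a row and vanishes. The surviving `d` are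
exactly those allowed by the box below and the box to the left.

An extracted unbarred letter moves left across all earlier rows; a barred one stays and waits for
the end of its diagonal. This produces the order prescribed by `sqread`. Everything rests on the
exchange relation `KronLetters.elemBelow_mul_next`: passing the next letter across `e_k` costs `Q *
e_{k-1}` with `Q` independent of `k`. It gives commutativity of the `e_k` with a common flag
(`KronLetters.elemBelow_commute`), hence rows with equal flags anticommute and square to zero, and
this in turn kills the error terms. A barred letter in front absorbs the only obstruction for later
barred letters (`barred_mul_elemBelow`). At the end of a diagonal the nonempty columns exhaust all
later generators, so the empty columns act as bare `ε_c` and the barred word passes them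
(`boxState_left`). When all boxes are gone, the words of the diagonals remain in front of the top
form, whose coefficient is unique. -/

/-- Elements `v 0, v 1, …` of a ring satisfying the defining relations of `U / I_kron`, where the
letters are numbered in their natural order; even indices are unbarred, odd ones barred. -/
structure KronLetters {R : Type*} [Ring R] (v : ℕ → R) : Prop where
  yyx : ∀ {x y}, Even y → x < y → v y * v y * v x = v y * v x * v y
  zyy : ∀ {y z}, Even y → y < z → v z * v y * v y = v y * v z * v y
  yyz : ∀ {y z}, Odd y → y < z → v y * v y * v z = v y * v z * v y
  xyy : ∀ {x y}, Odd y → x < y → v x * v y * v y = v y * v x * v y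
  rotate : ∀ x, (v x * v (x + 2) - v (x + 2) * v x) * v (x + 1) =
    v (x + 1) * (v x * v (x + 2) - v (x + 2) * v x)
  far : ∀ {x z}, x + 2 < z → v x * v z = v z * v x

/-! ### Elementary symmetric functions with bounded letters and their commutativity -/

section Elementary

variable {R : Type*} [Ring R]

/-- The elementary symmetric function of degree `k` in the letters below `n`. -/
def elemNat (v : ℕ → R) : ℕ → ℕ → R
  | 0, 0 => 1
  | 0, _ + 1 => 0
  | _ + 1, 0 => 1
  | n + 1, k + 1 => elemNat v n (k + 1) + v n * if Odd n then elemNat v (n + 1) k else elemNat v n k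
termination_by n k => (n, k)

/-- The elementary symmetric function of integral degree `k` in the letters below `n`. -/
def elemBelow (v : ℕ → R) (n : ℕ) (k : ℤ) : R :=
  if 0 ≤ k then elemNat v n k.toNat else 0

theorem elemNat_zero_right (v : ℕ → R) (n : ℕ) : elemNat v n 0 = 1 := by
  cases n <;> simp [elemNat]

theorem elemBelow_of_neg (v : ℕ → R) (n : ℕ) {k : ℤ} (hk : k < 0) : elemBelow v n k = 0 := by
  simp [elemBelow, not_le.2 hk]

theorem elemBelow_zero_right (v : ℕ → R) (n : ℕ) : elemBelow v n 0 = 1 := by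
  simp [elemBelow, elemNat_zero_right]

theorem elemBelow_zero_left (v : ℕ → R) (k : ℤ) : elemBelow v 0 k = if k = 0 then 1 else 0 := by
  rcases lt_trichotomy k 0 with h | rfl | h
  · rw [elemBelow_of_neg v 0 h, if_neg h.ne]
  · simp [elemBelow_zero_right]
  · obtain ⟨m, rfl⟩ := Int.eq_succ_of_zero_lt h
    rw [if_neg h.ne', elemBelow, if_pos h.le]
    simp [elemNat]

theorem elemBelow_succ_even (v : ℕ → R) {n : ℕ} (hn : Even n) (k : ℤ) :
    elemBelow v (n + 1) k = elemBelow v n k + v n * elemBelow v n (k - 1) := by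
  have hn' : ¬ Odd n := Nat.not_odd_iff_even.2 hn
  rcases lt_trichotomy k 0 with h | rfl | h
  · simp [elemBelow_of_neg, h, show k - 1 < 0 by lia]
  · simp [elemBelow_zero_right, elemBelow_of_neg]
  · obtain ⟨m, rfl⟩ := Int.eq_succ_of_zero_lt h
    simp only [elemBelow, if_pos h.le]
    simp [elemNat, hn']

theorem elemBelow_succ_odd (v : ℕ → R) {n : ℕ} (hn : Odd n) (k : ℤ) :
    elemBelow v (n + 1) k = elemBelow v n k + v n * elemBelow v (n + 1) (k - 1) := by
  rcases lt_trichotomy k 0 with h | rfl | h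
  · simp [elemBelow_of_neg, h, show k - 1 < 0 by lia]
  · simp [elemBelow_zero_right, elemBelow_of_neg]
  · obtain ⟨m, rfl⟩ := Int.eq_succ_of_zero_lt h
    simp only [elemBelow, if_pos h.le]
    simp [elemNat, hn]

/-- Integer induction for statements that hold in negative degrees. -/
theorem int_induction {P : ℤ → Prop} (hneg : ∀ k < 0, P k) (hstep : ∀ k, P (k - 1) → P k) (k : ℤ) :
    P k := by
  rcases lt_or_ge k 0 with h | h
  · exact hneg k h
  · obtain ⟨m, rfl⟩ := Int.eq_ofNat_of_zero_le h
    induction m with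
    | zero => exact hstep _ (hneg _ (by simp))
    | succ m ih => exact hstep _ (by simpa using ih (by positivity))

theorem elemBelow_induction {P : R → Prop} (v : ℕ → R) (n : ℕ) (h0 : P 0) (h1 : P 1)
    (hadd : ∀ a b, P a → P b → P (a + b)) (hmul : ∀ x < n, ∀ a, P a → P (v x * a)) (k : ℤ) :
    P (elemBelow v n k) := by
  induction n generalizing k with
  | zero => rw [elemBelow_zero_left]; split_ifs <;> assumption
  | succ n ih =>
    have ih := ih fun x hx => hmul x (by lia)
    rcases Nat.even_or_odd n with hn | hn
    · rw [elemBelow_succ_even v hn]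
      exact hadd _ _ (ih _) (hmul _ (by lia) _ (ih _))
    · refine int_induction (P := fun k => P (elemBelow v (n + 1) k))
        (fun k hk => by rwa [elemBelow_of_neg v _ hk]) (fun k hk => ?_) k
      rw [elemBelow_succ_odd v hn]
      exact hadd _ _ (ih _) (hmul _ (by lia) _ hk)

variable {v : ℕ → R}

theorem KronLetters.elemBelow_mul_far (hv : KronLetters v) {n z : ℕ} (h : n + 1 < z) (k : ℤ) :
    elemBelow v n k * v z = v z * elemBelow v n k := by
  refine elemBelow_induction (P := fun a => a * v z = v z * a) v n (by simp) (by simp)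
    (fun a b ha hb => by rw [add_mul, mul_add, ha, hb]) (fun x hx a ha => ?_) k
  rw [mul_assoc, ha, ← mul_assoc, hv.far (by lia), mul_assoc]

/-- The commutator with the next unbarred letter. -/
theorem mul_next_unbarred {b c y : R} {G D E : ℤ → R} (hG : ∀ k, G k * y = y * G k)
    (hD : ∀ k, D k = G k + c * G (k - 1)) (hE : ∀ k, E k = D k + b * E (k - 1))
    (hneg : ∀ k < 0, E k = 0) (hbby : b * b * y = b * y * b) (hycc : y * c * c = c * y * c)
    (hrot : (c * y - y * c) * b = b * (c * y - y * c)) (k : ℤ) :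
    E k * y = y * E k + ((c * y - y * c) + (b * y - y * b)) * E (k - 1) := by
  induction k using int_induction with
  | hneg k hk => simp [hneg, hk, show k - 1 < 0 by lia]
  | hstep k ih =>
  have h1 : D k * y = y * D k + (c * y - y * c) * G (k - 1) := by
    rw [hD, add_mul, mul_assoc, hG, hG]; noncomm_ring
  have h2 : E k * y = y * D k + (c * y - y * c) * G (k - 1) + b * (E (k - 1) * y) := by
    rw [hE k, add_mul, h1, mul_assoc]
  -- The commutator of `c` and `y` kills `c` from the left and commutes with `b`, so only the `G`
  -- part of `D` survives.
  have h3 : (c * y - y * c) * E (k - 1) = (c * y - y * c) * G (k - 1)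
      + b * (c * y - y * c) * E (k - 1 - 1) := by
    rw [← hrot, hE (k - 1), hD (k - 1)]
    have : (c * y - y * c) * (c * G (k - 1 - 1)) = 0 := by
      have : (c * y - y * c) * (c * G (k - 1 - 1)) = (c * y * c - y * c * c) * G (k - 1 - 1) := by
        noncomm_ring
      rw [this, hycc, sub_self, zero_mul]
    rw [mul_add, mul_add, this, add_zero, mul_assoc (c * y - y * c) b]
  have h4 : b * (b * y - y * b) * E (k - 1 - 1) = 0 := by
    have : b * (b * y - y * b) = b * b * y - b * y * b := by noncomm_ring
    rw [this, hbby, sub_self, zero_mul]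
  rw [h2, ih, add_mul (c * y - y * c) (b * y - y * b) (E (k - 1)), h3, hE k]
  have : b * (y * E (k - 1) + (c * y - y * c + (b * y - y * b)) * E (k - 1 - 1)) =
    b * y * E (k - 1) + b * (c * y - y * c) * E (k - 1 - 1) +
      b * (b * y - y * b) * E (k - 1 - 1) := by noncomm_ring
  rw [this, h4]
  noncomm_ring

/-- The commutator with the next barred letter. -/
theorem mul_next_barred {b c y : R} {G D E : ℤ → R} (hG : ∀ k, G k * y = y * G k)
    (hD : ∀ k, D k = G k + c * D (k - 1)) (hE : ∀ k, E k = D k + b * D (k - 1))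
    (hneg : ∀ k < 0, D k = 0) (hccy : c * c * y = c * y * c) (hybb : y * b * b = b * y * b)
    (hrot : (c * y - y * c) * b = b * (c * y - y * c)) (k : ℤ) :
    E k * y = y * E k + ((c * y - y * c) + (b * y - y * b)) * E (k - 1) := by
  have h1 (k : ℤ) : D k * y = y * D k + (c * y - y * c) * D (k - 1) := by
    induction k using int_induction with
    | hneg k hk => simp [hneg, hk, show k - 1 < 0 by lia]
    | hstep k ih =>
    have h2 : D k * y = y * G k + c * (D (k - 1) * y) := by
      rw [hD k, add_mul, hG, mul_assoc]
    have h3 : c * ((c * y - y * c) * D (k - 1 - 1)) = 0 := by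
      have : c * ((c * y - y * c) * D (k - 1 - 1)) = (c * c * y - c * y * c) * D (k - 1 - 1) := by
        noncomm_ring
      rw [this, hccy, sub_self, zero_mul]
    rw [h2, ih, mul_add, h3, hD k]
    noncomm_ring
  have h2 : (b * y - y * b) * E (k - 1) = (b * y - y * b) * D (k - 1) := by
    have : (b * y - y * b) * (b * D (k - 1 - 1)) = (b * y * b - y * b * b) * D (k - 1 - 1) := by
      noncomm_ring
    rw [hE, mul_add, this, hybb, sub_self, zero_mul, add_zero]
  have h3 : b * ((c * y - y * c) * D (k - 1 - 1)) = (c * y - y * c) * (b * D (k - 1 - 1)) := by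
    rw [← mul_assoc, ← hrot, mul_assoc]
  rw [add_mul, h2, hE (k - 1), mul_add, ← h3, hE k, add_mul, h1, mul_assoc b, h1]
  noncomm_ring

/-- Only the two letters just below `n` fail to commute with `v n`; `Q` is the sum of their
commutators with it. That `Q` does not depend on `k` makes the relation usable for whole rows, and
its annihilation by `v n`, on a side depending on parity, is what commutativity needs. -/
theorem KronLetters.elemBelow_mul_next (hv : KronLetters v) (n : ℕ) :
    ∃ Q : R, (∀ k, elemBelow v n k * v n = v n * elemBelow v n k + Q * elemBelow v n (k - 1)) ∧
      (Even n → v n * Q = 0) ∧ (Odd n → Q * v n = 0) := by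
  rcases n with _ | _ | n
  · refine ⟨0, fun k => ?_, by simp, by simp⟩
    rw [elemBelow_zero_left]; split_ifs <;> simp
  · refine ⟨v 0 * v 1 - v 1 * v 0, fun k => ?_, by simp, fun h => ?_⟩
    -- Only one letter lies below letter 1, so zero stands in for the second one.
    · simpa using mul_next_barred (c := 0) (b := v 0) (y := v 1) (G := elemBelow v 0)
        (D := elemBelow v 0) (E := elemBelow v 1)
        (fun k => by rw [elemBelow_zero_left]; split_ifs <;> simp) (by simp)
        (elemBelow_succ_even v (by simp)) (fun k hk => elemBelow_of_neg v _ hk) (by simp)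
        (hv.zyy (by simp) (by simp)) (by simp) k
    · rw [sub_mul, hv.xyy h (by simp), sub_self]
  · refine ⟨(v n * v (n + 2) - v (n + 2) * v n) +
      (v (n + 1) * v (n + 2) - v (n + 2) * v (n + 1)), ?_, fun h => ?_, fun h => ?_⟩
    · rcases Nat.even_or_odd n with hn | hn
      · exact mul_next_unbarred (fun k => hv.elemBelow_mul_far (by lia) k)
          (elemBelow_succ_even v hn) (elemBelow_succ_odd v hn.add_one)
          (fun k hk => elemBelow_of_neg v _ hk) (hv.yyz hn.add_one (by lia))
          (hv.zyy hn (by lia)) (hv.rotate n)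
      · exact mul_next_barred (fun k => hv.elemBelow_mul_far (by lia) k)
          (elemBelow_succ_odd v hn) (elemBelow_succ_even v hn.add_one)
          (fun k hk => elemBelow_of_neg v _ hk) (hv.yyz hn (by lia))
          (hv.zyy hn.add_one (by lia)) (hv.rotate n)
    · have h1 := hv.yyx h (show n < n + 2 by lia)
      have h2 := hv.yyx h (show n + 1 < n + 2 by lia)
      rw [mul_add, mul_sub, mul_sub, ← mul_assoc, ← mul_assoc, ← mul_assoc, ← mul_assoc, h1, h2]
      simp
    · have h1 := hv.xyy h (show n < n + 2 by lia)
      have h2 := hv.xyy h (show n + 1 < n + 2 by lia)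
      rw [add_mul, sub_mul, sub_mul, h1, h2]
      simp

/-- After moving `y` to the left, and using `y * Q = 0`, the product `F k * F l` becomes an
expression symmetric in `k` and `l`. -/
theorem commute_next_unbarred {y Q : R} {E F : ℤ → R} (hF : ∀ k, F k = E k + y * E (k - 1))
    (hE : ∀ k l, E k * E l = E l * E k) (hy : ∀ k, E k * y = y * E k + Q * E (k - 1))
    (hQ : y * Q = 0) (k l : ℤ) : F k * F l = F l * F k := by
  have key (k l : ℤ) : F k * F l = E k * E l + y * (E (k - 1) * E l + E k * E (l - 1)) +
      Q * (E (k - 1) * E (l - 1)) + y * y * (E (k - 1) * E (l - 1)) := by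
    rw [hF, hF]
    have : (E k + y * E (k - 1)) * (E l + y * E (l - 1)) = E k * E l + y * (E (k - 1) * E l) +
      E k * y * E (l - 1) + y * (E (k - 1) * y) * E (l - 1) := by noncomm_ring
    rw [this, hy, hy, mul_add, ← mul_assoc y Q, hQ]
    noncomm_ring
  rw [key, key, hE k l, hE (k - 1) l, hE k (l - 1), hE (k - 1) (l - 1), add_comm (E l * E (k - 1))]

/-- A repeatable letter gives a recursion of `F` through itself, so `F k * F l` is expressed through
products of smaller total degree. Induction on `k + l` makes the expression symmetric; in negative
total degree one factor is zero. -/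
theorem commute_next_barred {y Q : R} {E F : ℤ → R} (hF : ∀ k, F k = E k + y * F (k - 1))
    (hE : ∀ k l, E k * E l = E l * E k) (hy : ∀ k, E k * y = y * E k + Q * E (k - 1))
    (hQ : Q * y = 0) (hneg : ∀ k < 0, F k = 0) (k l : ℤ) : F k * F l = F l * F k := by
  have hQF (k : ℤ) : Q * F k = Q * E k := by
    rw [hF, mul_add, ← mul_assoc, hQ, zero_mul, add_zero]
  have key (k l : ℤ) : F k * F l = E k * E l + y * (F (k - 1) * F l) + y * (F k * F (l - 1)) -
      y * y * (F (k - 1) * F (l - 1)) + Q * (F (k - 1) * F (l - 1)) := by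
    have h1 : F k * F l = E k * E l + y * (F (k - 1) * F l) + E k * y * F (l - 1) := by
      conv_lhs => rw [hF k, add_mul, hF l, mul_add, ← hF l]
      noncomm_ring
    have h2 : y * (F k * F (l - 1)) = y * E k * F (l - 1) + y * y * (F (k - 1) * F (l - 1)) := by
      rw [hF k]; noncomm_ring
    rw [h1, h2, ← mul_assoc Q, hQF, hy]
    noncomm_ring
  have main (m : ℕ) : ∀ k l : ℤ, k + l < m → F k * F l = F l * F k := by
    induction m with
    | zero =>
      intro k l h
      rcases lt_or_ge k 0 with hk | hk
      · simp [hneg k hk]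
      · simp [hneg l (by push_cast at h; lia)]
    | succ m ih =>
      intro k l h
      push_cast at h
      rw [key k l, key l k, ih (k - 1) l (by lia), ih k (l - 1) (by lia),
        ih (k - 1) (l - 1) (by lia), hE k l]
      abel
  exact main (k + l).toNat.succ k l (by push_cast; lia)

theorem KronLetters.elemBelow_commute (hv : KronLetters v) (n : ℕ) (k l : ℤ) :
    elemBelow v n k * elemBelow v n l = elemBelow v n l * elemBelow v n k := by
  induction n generalizing k l with
  | zero => simp only [elemBelow_zero_left]; split_ifs <;> simp
  | succ n ih =>
    obtain ⟨Q, h1, h2, h3⟩ := hv.elemBelow_mul_next n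
    rcases Nat.even_or_odd n with hn | hn
    · exact commute_next_unbarred (elemBelow_succ_even v hn) ih h1 (h2 hn) k l
    · exact commute_next_barred (elemBelow_succ_odd v hn) ih h1 (h3 hn)
        (fun k hk => elemBelow_of_neg v _ hk) k l

end Elementary

/-- Elements `ε 0, ε 1, …` of a ring that behave like the generators of an exterior algebra with
coefficients in `R`. -/
structure WedgeBasis {R B : Type*} [Ring R] [Ring B] (φ : R →+* B) (ε : ℕ → B) : Prop where
  comm : ∀ r c, ε c * φ r = φ r * ε c
  sq : ∀ c, ε c * ε c = 0
  anticomm : ∀ c d, ε c * ε d = -(ε d * ε c)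

/-! ### Rows of the determinant in the exterior algebra -/

section Rows

variable {R B : Type*} [Ring R] [Ring B] (φ : R →+* B) (ε : ℕ → B) (v : ℕ → R) (l : ℕ)

/-- A row of the matrix of a noncommutative flagged Schur function, as an element of the exterior
algebra: the letters are below `2 * m`, and `a` is the degree of the entry in column `0`. -/
def row (m : ℕ) (a : ℤ) : B :=
  ∑ c ∈ Finset.range l, φ (elemBelow v (2 * m) (a + c)) * ε c

variable {φ ε v l}

theorem WedgeBasis.mul_mul_mul (hε : WedgeBasis φ ε) (r s : R) (c d : ℕ) :
    φ r * ε c * (φ s * ε d) = φ (r * s) * (ε c * ε d) := by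
  rw [mul_assoc, ← mul_assoc (ε c), hε.comm, map_mul]
  simp only [mul_assoc]

theorem row_anticomm (hε : WedgeBasis φ ε) (hv : KronLetters v) (m : ℕ) (a b : ℤ) :
    row φ ε v l m a * row φ ε v l m b = -(row φ ε v l m b * row φ ε v l m a) := by
  simp only [row, Finset.sum_mul_sum, hε.mul_mul_mul]
  rw [Finset.sum_comm, ← Finset.sum_neg_distrib]
  refine Finset.sum_congr rfl fun c _ => ?_
  rw [← Finset.sum_neg_distrib]
  refine Finset.sum_congr rfl fun d _ => ?_
  rw [hv.elemBelow_commute, hε.anticomm, mul_neg]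

/-- The terms for `(c, d)` and `(d, c)` cancel. Anticommutativity alone would not suffice, since the
ring may have 2-torsion. -/
theorem row_mul_self (hε : WedgeBasis φ ε) (hv : KronLetters v) (m : ℕ) (a : ℤ) :
    row φ ε v l m a * row φ ε v l m a = 0 := by
  simp only [row, Finset.sum_mul_sum, hε.mul_mul_mul]
  rw [← Finset.sum_product']
  refine Finset.sum_involution (fun p _ => (p.2, p.1)) (fun p _ => ?_) (fun p _ h h' => ?_)
    (fun p hp => ?_) (fun p _ => rfl)
  · rw [hv.elemBelow_commute, hε.anticomm, mul_neg, neg_add_cancel]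
  · rw [← congrArg Prod.snd h', hε.sq, mul_zero] at h
    exact h rfl
  · simpa [and_comm] using hp

theorem row_mul_far (hε : WedgeBasis φ ε) (hv : KronLetters v) {m z : ℕ} (h : 2 * m + 1 < z)
    (a : ℤ) : row φ ε v l m a * φ (v z) = φ (v z) * row φ ε v l m a := by
  simp only [row, Finset.sum_mul, Finset.mul_sum]
  refine Finset.sum_congr rfl fun c _ => ?_
  rw [mul_assoc, hε.comm, ← mul_assoc, ← mul_assoc, ← map_mul, ← map_mul,
    hv.elemBelow_mul_far h]

/-- The exchange error is `Q` times the row of degree `a - 1`, and the hypothesis on `X` removes it.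
-/
theorem row_mul_next (hε : WedgeBasis φ ε) (hv : KronLetters v) {m : ℕ} {a : ℤ} {X : B}
    (hX : row φ ε v l m (a - 1) * X = 0) :
    row φ ε v l m a * (φ (v (2 * m)) * X) = φ (v (2 * m)) * (row φ ε v l m a * X) := by
  obtain ⟨Q, hQ, -, -⟩ := hv.elemBelow_mul_next (2 * m)
  have : row φ ε v l m a * φ (v (2 * m)) =
      φ (v (2 * m)) * row φ ε v l m a + φ Q * row φ ε v l m (a - 1) := by
    simp only [row, Finset.sum_mul, Finset.mul_sum]
    rw [← Finset.sum_add_distrib]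
    refine Finset.sum_congr rfl fun c _ => ?_
    rw [mul_assoc, hε.comm, ← mul_assoc, ← map_mul, hQ, map_add, add_mul, map_mul, map_mul,
      mul_assoc, mul_assoc, show a + c - 1 = a - 1 + c by ring]
  rw [← mul_assoc, this, add_mul, mul_assoc (φ Q), hX, mul_zero, add_zero, mul_assoc]

/-- Among the letters involved only `2 * m + 1` fails to commute with `2 * m + 3`. With one copy of
it in front, the relation `yyz` lets `2 * m + 3` pass every further copy. -/
theorem KronLetters.barred_mul_elemBelow (hv : KronLetters v) (m : ℕ) (k : ℤ) :
    v (2 * m + 1) * elemBelow v (2 * m + 2) k * v (2 * m + 3) =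
      v (2 * m + 1) * v (2 * m + 3) * elemBelow v (2 * m + 2) k := by
  induction k using int_induction with
  | hneg k hk => simp [elemBelow_of_neg v _ hk]
  | hstep k ih =>
    have h1 := hv.elemBelow_mul_far (n := 2 * m + 1) (z := 2 * m + 3) (by lia) k
    have h2 := hv.yyz (y := 2 * m + 1) (z := 2 * m + 3) (by simp) (by lia)
    rw [elemBelow_succ_odd v (n := 2 * m + 1) (by simp), mul_add, mul_add, add_mul, mul_assoc, h1,
      mul_assoc, mul_assoc]
    rw [mul_assoc] at ih
    rw [ih]
    simp only [← mul_assoc]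
    rw [h2]

theorem barred_mul_row (hε : WedgeBasis φ ε) (hv : KronLetters v) (m : ℕ) (a : ℤ) :
    φ (v (2 * m + 1)) * row φ ε v l (m + 1) a * φ (v (2 * m + 3)) =
      φ (v (2 * m + 1)) * φ (v (2 * m + 3)) * row φ ε v l (m + 1) a := by
  simp only [row, Finset.sum_mul, Finset.mul_sum]
  refine Finset.sum_congr rfl fun c _ => ?_
  rw [mul_assoc, mul_assoc, hε.comm, ← mul_assoc (φ (elemBelow _ _ _)), ← mul_assoc, ← map_mul,
    ← map_mul, ← mul_assoc, show 2 * (m + 1) = 2 * m + 2 by ring, hv.barred_mul_elemBelow]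
  simp only [map_mul, mul_assoc]

theorem row_succ (m : ℕ) (a : ℤ) :
    row φ ε v l (m + 1) a = row φ ε v l m a + φ (v (2 * m)) * row φ ε v l m (a - 1) +
      φ (v (2 * m + 1)) * row φ ε v l (m + 1) (a - 1) := by
  simp only [row, Finset.mul_sum]
  rw [← Finset.sum_add_distrib, ← Finset.sum_add_distrib]
  refine Finset.sum_congr rfl fun c _ => ?_
  rw [show 2 * (m + 1) = 2 * m + 1 + 1 by ring, elemBelow_succ_odd v (n := 2 * m + 1) (by simp),
    elemBelow_succ_even v (n := 2 * m) (by simp), show a + c - 1 = a - 1 + c by ring]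
  simp only [map_add, map_mul, add_mul, mul_assoc]

/-- Extracting the first letter of every term with a letter not below `2 * n`. -/
theorem row_eq_add_sum {n m : ℕ} (h : n ≤ m) (a : ℤ) :
    row φ ε v l m a = row φ ε v l n a +
      ∑ d ∈ Finset.Ico (2 * n) (2 * m), φ (v d) * row φ ε v l ((d + 1) / 2) (a - 1) := by
  induction m, h using Nat.le_induction with
  | base => simp
  | succ m h ih =>
    rw [row_succ, ih, show 2 * (m + 1) = 2 * m + 1 + 1 by ring, Finset.sum_Ico_succ_top (by lia),
      Finset.sum_Ico_succ_top (by lia), show (2 * m + 1) / 2 = m by lia,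
      show (2 * m + 1 + 1) / 2 = m + 1 by lia]
    abel

theorem row_zero (a : ℤ) (ha : 0 < a) : row φ ε v l 0 a = 0 := by
  refine Finset.sum_eq_zero fun c _ => ?_
  rw [mul_zero, elemBelow_zero_left, if_neg (by lia), map_zero, zero_mul]

end Rows

/-! ### Vanishing of wedge products and rows of empty columns -/

section Kill

variable {R B : Type*} [Ring R] [Ring B] {φ : R →+* B} {ε : ℕ → B} {v : ℕ → R} {l : ℕ}

theorem WedgeBasis.mul_prod_of_mem (hε : WedgeBasis φ ε) {c : ℕ} {L : List ℕ} (h : c ∈ L) :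
    ε c * (L.map ε).prod = 0 := by
  induction L with
  | nil => simp at h
  | cons d L ih =>
    rw [List.map_cons, List.prod_cons, ← mul_assoc]
    rcases List.mem_cons.1 h with rfl | h
    · rw [hε.sq, zero_mul]
    · rw [hε.anticomm, neg_mul, mul_assoc, ih h, mul_zero, neg_zero]

theorem WedgeBasis.prod_eq_zero (hε : WedgeBasis φ ε) {L : List ℕ} (h : ¬ L.Nodup) :
    (L.map ε).prod = 0 := by
  induction L with
  | nil => simp at h
  | cons d L ih =>
    rw [List.map_cons, List.prod_cons]
    by_cases hd : d ∈ L
    · exact hε.mul_prod_of_mem hd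
    · rw [ih fun h' => h (List.nodup_cons.2 ⟨hd, h'⟩), mul_zero]

/-- A product of `k` linear combinations of the `ε c`, `c ∈ S`, is a combination of products of
`k` such elements. -/
theorem WedgeBasis.prod_mem_closure (hε : WedgeBasis φ ε) (S : Finset ℕ) (L : List B)
    (hL : ∀ x ∈ L, ∃ r : ℕ → R, x = ∑ c ∈ S, φ (r c) * ε c) :
    L.prod ∈ AddSubmonoid.closure
      {x | ∃ r, ∃ C : List ℕ, C.length = L.length ∧ (∀ c ∈ C, c ∈ S) ∧
        x = φ r * (C.map ε).prod} := by
  induction L with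
  | nil => exact AddSubmonoid.subset_closure ⟨1, [], by simp⟩
  | cons x L ih =>
    obtain ⟨r, rfl⟩ := hL x (by simp)
    rw [List.prod_cons, Finset.sum_mul]
    refine AddSubmonoid.sum_mem _ fun c hc => ?_
    have ih := ih fun y hy => hL y (by simp [hy])
    generalize L.prod = p at ih
    induction ih using AddSubmonoid.closure_induction with
    | mem y hy =>
      obtain ⟨s, C, h1, h2, rfl⟩ := hy
      refine AddSubmonoid.subset_closure ⟨r c * s, c :: C, by simp [h1], by simpa [hc] using h2, ?_⟩
      rw [List.map_cons, List.prod_cons, mul_assoc, ← mul_assoc (ε c), hε.comm, map_mul]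
      simp only [mul_assoc]
    | zero => rw [mul_zero]; exact zero_mem _
    | add y z _ _ hy hz => rw [mul_add]; exact add_mem hy hz

/-- Pigeonhole: every term of the expanded product repeats some `ε c`. -/
theorem WedgeBasis.prod_eq_zero_of_card_lt (hε : WedgeBasis φ ε) (S : Finset ℕ) (L : List B)
    (hL : ∀ x ∈ L, ∃ r : ℕ → R, x = ∑ c ∈ S, φ (r c) * ε c) (h : S.card < L.length) :
    L.prod = 0 := by
  have hmem := hε.prod_mem_closure S L hL
  generalize L.prod = p at hmem ⊢
  induction hmem using AddSubmonoid.closure_induction with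
  | mem y hy =>
    obtain ⟨s, C, h1, h2, rfl⟩ := hy
    rw [hε.prod_eq_zero, mul_zero]
    intro hC
    have : C.toFinset ⊆ S := fun c hc => h2 c (by simpa using hc)
    have := Finset.card_le_card this
    rw [List.toFinset_card_of_nodup hC] at this
    lia
  | zero => rfl
  | add y z _ _ hy hz => rw [hy, hz, add_zero]

/-- The rows from `j` on use up all columns from `j` on, if they have no earlier entries. -/
theorem WedgeBasis.mul_rows_eq_zero (hε : WedgeBasis φ ε) {j c : ℕ} (f : ℕ → B)
    (hf : ∀ i, j ≤ i → i < l → ∃ m, ∃ a : ℤ, a ≤ -j ∧ f i = row φ ε v l m a)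
    (hc : j ≤ c) (hcl : c < l) : ε c * ((List.range' j (l - j)).map f).prod = 0 := by
  rw [← List.prod_cons]
  -- Together with `ε c`, the `l - j` rows are `l - j + 1` combinations of the `l - j` generators
  -- with index in `[j, l)`.
  refine hε.prod_eq_zero_of_card_lt (Finset.Ico j l) _ (fun x hx => ?_) (by simp)
  rcases List.mem_cons.1 hx with rfl | hx
  · refine ⟨fun d => if d = c then 1 else 0, ?_⟩
    rw [Finset.sum_eq_single_of_mem c (by simp; lia)]
    · simp
    · intro d _ hd; simp [hd]
  · obtain ⟨i, hi, rfl⟩ := List.mem_map.1 hx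
    rw [List.mem_range'_1] at hi
    obtain ⟨m, a, ha, hfi⟩ := hf i (by lia) (by lia)
    refine ⟨fun d => elemBelow v (2 * m) (a + d), ?_⟩
    rw [hfi, row, Finset.range_eq_Ico, ← Finset.sum_Ico_consecutive _ (Nat.zero_le j) (by lia),
      Finset.sum_eq_zero, zero_add]
    intro d hd
    rw [Finset.mem_Ico] at hd
    rw [elemBelow_of_neg _ _ (by lia), map_zero, zero_mul]

/-- The empty columns contribute trivially if the later rows use up all later columns. -/
theorem WedgeBasis.prod_rows_mul (hε : WedgeBasis φ ε) {j : ℕ} (hj : j ≤ l) (m : ℕ → ℕ) {X : B}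
    (hX : ∀ c, j ≤ c → c < l → ε c * X = 0) :
    ((List.range j).map fun i => row φ ε v l (m i) (-i)).prod * X =
      ((List.range j).map ε).prod * X := by
  induction j generalizing X with
  | zero => simp
  | succ j ih =>
    have h : row φ ε v l (m j) (-j) * X = ε j * X := by
      rw [row, Finset.sum_mul, Finset.sum_eq_single_of_mem j (by simp; lia)]
      · simp [elemBelow_zero_right]
      · intro c hc hcj
        rcases lt_or_gt_of_ne hcj with h | h
        · rw [elemBelow_of_neg _ _ (by lia)]; simp
        · rw [mul_assoc, hX c h (by simpa using hc), mul_zero]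
    rw [List.range_succ, List.map_append, List.map_append, List.prod_append, List.prod_append,
      mul_assoc, mul_assoc]
    simp only [List.map_cons, List.map_nil, List.prod_cons, List.prod_nil, mul_one]
    rw [h]
    refine ih (by lia) fun c hc hcl => ?_
    rcases hc.eq_or_lt with rfl | hc
    · rw [← mul_assoc, hε.sq, zero_mul]
    · rw [← mul_assoc, hε.anticomm, neg_mul, mul_assoc, hX c hc hcl, mul_zero, neg_zero]

theorem WedgeBasis.prod_mul_coeff (hε : WedgeBasis φ ε) (L : List ℕ) (r : R) :
    (L.map ε).prod * φ r = φ r * (L.map ε).prod := by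
  induction L with
  | nil => simp
  | cons c L ih => rw [List.map_cons, List.prod_cons, mul_assoc, ih, ← mul_assoc, hε.comm, mul_assoc]

/-- A coefficient can be moved across the rows of the empty columns. -/
theorem WedgeBasis.prod_rows_mul_comm (hε : WedgeBasis φ ε) {j : ℕ} (hj : j ≤ l) (m : ℕ → ℕ)
    {X : B} (hX : ∀ c, j ≤ c → c < l → ε c * X = 0) (r : R) :
    ((List.range j).map fun i => row φ ε v l (m i) (-i)).prod * (φ r * X) =
      φ r * (((List.range j).map fun i => row φ ε v l (m i) (-i)).prod * X) := by
  rw [hε.prod_rows_mul hj m hX, hε.prod_rows_mul hj m, ← mul_assoc, hε.prod_mul_coeff, mul_assoc]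
  intro c h1 h2
  rw [← mul_assoc, hε.comm, mul_assoc, hX c h1 h2, mul_zero]

end Kill

/-! ### Moving letters across rows -/

section Move

variable {R B : Type*} [Ring R] [Ring B] {φ : R →+* B} {ε : ℕ → B} {v : ℕ → R} {l : ℕ}

/-- An unbarred letter that is not below any of the flags can be moved across the rows to the
front. -/
theorem prod_rows_mul_unbarred (hε : WedgeBasis φ ε) (hv : KronLetters v) (m : ℕ → ℕ) (a : ℕ → ℤ)
    (k j : ℕ) (hm : ∀ i, i + 1 < j → m i ≤ m (i + 1)) (hk : ∀ i < j, m i ≤ k)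
    (ha : ∀ i, i + 1 < j → a i = a (i + 1) ∨ a i = a (i + 1) + 1) (X : B)
    (hX : 0 < j → m (j - 1) = k → row φ ε v l k (a (j - 1) - 1) * X = 0) :
    ((List.range j).map fun i => row φ ε v l (m i) (a i)).prod * (φ (v (2 * k)) * X) =
      φ (v (2 * k)) * (((List.range j).map fun i => row φ ε v l (m i) (a i)).prod * X) := by
  induction j generalizing X with
  | zero => simp
  | succ j ih =>
    have h : row φ ε v l (m j) (a j) * (φ (v (2 * k)) * X) =
        φ (v (2 * k)) * (row φ ε v l (m j) (a j) * X) := by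
      rcases (hk j (by lia)).eq_or_lt with h | h
      · rw [h]
        exact row_mul_next hε hv (hX (by lia) (by simpa using h))
      · rw [← mul_assoc, row_mul_far hε hv (by lia), mul_assoc]
    rw [List.range_succ, List.map_append, List.prod_append, mul_assoc, mul_assoc]
    simp only [List.map_cons, List.map_nil, List.prod_cons, List.prod_nil, mul_one]
    rw [h]
    refine ih (fun i hi => hm i (by lia)) (fun i hi => hk i (by lia)) (fun i hi => ha i (by lia))
      _ fun hj hmk => ?_
    have hmj : m j = k := by
      have h1 := hm (j - 1) (by lia)
      have h2 := hk j (by lia)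
      rw [Nat.sub_add_cancel hj] at h1
      lia
    have hX := hX (by lia) (by simpa using hmj)
    have haj := ha (j - 1) (by lia)
    rw [Nat.add_sub_cancel] at hX
    rw [Nat.sub_add_cancel hj] at haj
    rw [hmj, ← mul_assoc]
    -- The error row meets the row of column `j`, which has the same flag. For equal degrees the two
    -- anticommute and the error reaches `X`, which it kills; if the degree drops by one they
    -- coincide and the square is zero.
    rcases haj with h | h
    · rw [h, row_anticomm hε hv, neg_mul, mul_assoc, hX, mul_zero, neg_zero]
    · rw [h, add_sub_cancel_right, row_mul_self hε hv, zero_mul]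

theorem row_mul_word_far (hε : WedgeBasis φ ε) (hv : KronLetters v) {m : ℕ} (a : ℤ) (L : List ℕ)
    (h : ∀ z ∈ L, 2 * m + 1 < z) :
    row φ ε v l m a * φ (L.map v).prod = φ (L.map v).prod * row φ ε v l m a := by
  induction L with
  | nil => simp
  | cons z L ih =>
    rw [List.map_cons, List.prod_cons, map_mul, ← mul_assoc, row_mul_far hε hv (h z (by simp)),
      mul_assoc, ih fun y hy => h y (by simp [hy]), mul_assoc]

/-- Only the first letter of `L` can be `2 * m + 3`, and `v (2 * m + 1)` in front lets it pass. By
the pairwise condition all later letters are larger, hence far from the row. -/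
theorem barred_mul_row_mul_word (hε : WedgeBasis φ ε) (hv : KronLetters v) (m : ℕ) (a : ℤ)
    (L : List ℕ) (hodd : ∀ z ∈ L, Odd z) (hm : ∀ z ∈ L, 2 * m + 2 ≤ z)
    (hL : L.Pairwise fun x y => 2 * ((x + 1) / 2) ≤ y) :
    φ (v (2 * m + 1)) * row φ ε v l (m + 1) a * φ (L.map v).prod =
      φ (v (2 * m + 1)) * φ (L.map v).prod * row φ ε v l (m + 1) a := by
  cases L with
  | nil => simp
  | cons z L =>
    have h1 := hm z (by simp)
    obtain ⟨q, hq⟩ := hodd z (by simp)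
    have h2 : row φ ε v l (m + 1) a * φ (L.map v).prod =
        φ (L.map v).prod * row φ ε v l (m + 1) a := by
      refine row_mul_word_far hε hv a L fun y hy => ?_
      have h3 := (List.pairwise_cons.1 hL).1 y hy
      obtain ⟨p, hp⟩ := hodd y (by simp [hy])
      lia
    have h3 : φ (v (2 * m + 1)) * row φ ε v l (m + 1) a * φ (v z) =
        φ (v (2 * m + 1)) * φ (v z) * row φ ε v l (m + 1) a := by
      by_cases hz : z = 2 * m + 3
      · rw [hz]; exact barred_mul_row hε hv m a
      · rw [mul_assoc, row_mul_far hε hv (by lia), ← mul_assoc]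
    rw [List.map_cons, List.prod_cons, map_mul, ← mul_assoc, h3, mul_assoc, h2]
    simp only [mul_assoc]

end Move

/-- The product of the unbarred letters of `D` in reverse order. -/
def unbarredWord {R : Type*} [Ring R] (v : ℕ → R) (D : List ℕ) : R :=
  ((D.filter fun x => ¬ Odd x).reverse.map v).prod

/-- The product of the barred letters of `D`. -/
def barredWord {R : Type*} [Ring R] (v : ℕ → R) (D : List ℕ) : R :=
  ((D.filter fun x => Odd x).map v).prod

/-! ### Partially filled diagrams and their flags -/

section Peel

/-- The number of boxes in column `c` that remain after removing the boxes `(i, c)` with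
`c + r - i < k`, if there were `h c` boxes. -/
def remaining (h : ℕ → ℕ) (r k c : ℕ) : ℕ := min (h c) (c + r + 1 - k)

/-- The flag of column `c` if it is filled by `t` from row `s` on. -/
def flag (N : ℕ) (h : ℕ → ℕ) (t : ℕ → ℕ → ℕ) (s c : ℕ) : ℕ :=
  if s < h c then (t s c + 1) / 2 else N

/-- The entries on the diagonal with index `k` in the columns from `j` on. -/
def diagFrom (h : ℕ → ℕ) (r l : ℕ) (t : ℕ → ℕ → ℕ) (k j : ℕ) : List ℕ :=
  (List.range' j (l - j)).filterMap fun c =>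
    if k ≤ c + r ∧ c + r - k < h c then some (t (c + r - k) c) else none

/-- The entry in box `(i, c)` is compatible with those below it and to the left of it. -/
def LocallyOK (N : ℕ) (h : ℕ → ℕ) (t : ℕ → ℕ → ℕ) (i c : ℕ) : Prop :=
  t i c < 2 * flag N h t (i + 1) c ∧ (0 < c → 2 * flag N h t i (c - 1) ≤ t i c)

/-- Change one entry. -/
def setEntry (t : ℕ → ℕ → ℕ) (i c d : ℕ) : ℕ → ℕ → ℕ :=
  fun i' c' => if i' = i ∧ c' = c then d else t i' c'

theorem setEntry_of_ne (t : ℕ → ℕ → ℕ) {i c : ℕ} (d : ℕ) {i' c' : ℕ} (hne : ¬ (i' = i ∧ c' = c)) :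
    setEntry t i c d i' c' = t i' c' := if_neg hne

theorem setEntry_self (t : ℕ → ℕ → ℕ) (i c d : ℕ) : setEntry t i c d i c = d := by
  simp [setEntry]

variable {N r l : ℕ} {h : ℕ → ℕ} {t : ℕ → ℕ → ℕ}

theorem diagFrom_eq_nil (k : ℕ) {j : ℕ} (hj : l ≤ j) : diagFrom h r l t k j = [] := by
  simp [diagFrom, Nat.sub_eq_zero_of_le hj]

theorem diagFrom_eq {k j : ℕ} (hj : j < l) : diagFrom h r l t k j =
    (if k ≤ j + r ∧ j + r - k < h j then [t (j + r - k) j] else []) ++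
      diagFrom h r l t k (j + 1) := by
  rw [diagFrom, show l - j = l - (j + 1) + 1 by lia, List.range'_succ,
    List.filterMap_cons, diagFrom]
  by_cases hp : k ≤ j + r ∧ j + r - k < h j <;> simp [hp]

theorem diagFrom_eq_nil_of_le (hh : Antitone h) {k j : ℕ} (hj : h j + k ≤ j + r) :
    diagFrom h r l t k j = [] := by
  rw [diagFrom, List.filterMap_eq_nil_iff]
  intro c hc
  rw [List.mem_range'_1] at hc
  have := hh hc.1
  rw [if_neg]
  lia

theorem diagFrom_congr {t t' : ℕ → ℕ → ℕ} {k j : ℕ}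
    (htt : ∀ i c, j ≤ c → c + r = k + i → t i c = t' i c) :
    diagFrom h r l t k j = diagFrom h r l t' k j := by
  refine List.filterMap_congr fun c hc => ?_
  rw [List.mem_range'_1] at hc
  split_ifs with hp
  · rw [htt _ _ hc.1 (by lia)]
  · rfl

theorem flag_congr {t t' : ℕ → ℕ → ℕ} {s c : ℕ} (htt : t s c = t' s c) :
    flag N h t s c = flag N h t' s c := by
  rw [flag, flag, htt]

theorem flag_le {s c : ℕ} (ht : s < h c → t s c < 2 * N) : flag N h t s c ≤ N := by
  rw [flag]; split_ifs with hs
  · have := ht hs; lia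
  · rfl

/-- The entries in the boxes with diagonal index less than `k` are compatible with their
neighbours. -/
def OKBefore (N : ℕ) (h : ℕ → ℕ) (r : ℕ) (t : ℕ → ℕ → ℕ) (k : ℕ) : Prop :=
  ∀ i c, i < h c → c + r < k + i → LocallyOK N h t i c

theorem LocallyOK.lt {i c : ℕ} (ht : LocallyOK N h t i c)
    (hlt : i + 1 < h c → t (i + 1) c < 2 * N) : t i c < 2 * N :=
  ht.1.trans_le (Nat.mul_le_mul_left 2 (flag_le hlt))

theorem OKBefore.lt {k : ℕ} (ht : OKBefore N h r t k) {i c : ℕ} (hi : i < h c)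
    (hk : c + r < k + i) : t i c < 2 * N := by
  obtain ⟨n, hn⟩ : ∃ n, n = h c - i := ⟨_, rfl⟩
  induction n generalizing i with
  | zero => lia
  | succ n ih => exact (ht i c hi hk).lt fun hi' => ih hi' (by lia) (by lia)

/-- When the first filled boxes are `(s, c)` and `(s + 1, c + 1)`, compare them through `(s + 1,
c)`, which lies below the one and left of the other. If both columns are entirely filled, the boxes
are horizontal neighbours; if column `c + 1` is untouched, its flag is the maximum `N`. -/
theorem OKBefore.flag_le_succ (hh : Antitone h) (hr : ∀ c, h c ≤ r) {k : ℕ}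
    (ht : OKBefore N h r t k) (c : ℕ) :
    flag N h t (remaining h r k c) c ≤ flag N h t (remaining h r k (c + 1)) (c + 1) := by
  have hc := hh (Nat.le_succ c)
  have hrc := hr c
  by_cases h1 : remaining h r k (c + 1) < h (c + 1)
  · by_cases h2 : k ≤ c + 1 + r
    · have e1 : remaining h r k (c + 1) = c + 1 + r + 1 - k := by rw [remaining] at h1 ⊢; lia
      have e2 : remaining h r k c = c + 1 + r - k := by rw [remaining]; lia
      rw [e1] at h1
      have l1 := (ht (c + 1 + r - k) c (by lia) (by lia)).1
      have l2 := (ht (c + 1 + r - k + 1) (c + 1) (by lia) (by lia)).2 (by lia)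
      rw [e1, e2, show c + 1 + r + 1 - k = c + 1 + r - k + 1 by lia]
      rw [Nat.add_sub_cancel] at l2
      rw [flag, if_pos (by lia), flag, if_pos (by lia)]
      lia
    · have e1 : remaining h r k (c + 1) = 0 := by rw [remaining]; lia
      have e2 : remaining h r k c = 0 := by rw [remaining]; lia
      rw [e1] at h1
      have l2 := (ht 0 (c + 1) (by lia) (by lia)).2 (by lia)
      rw [e1, e2]
      rw [Nat.add_sub_cancel] at l2
      have : flag N h t 0 (c + 1) = (t 0 (c + 1) + 1) / 2 := if_pos h1
      lia
  · refine (flag_le fun hs => ht.lt hs ?_).trans_eq (by rw [flag, if_neg h1])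
    rw [remaining] at hs ⊢
    lia

theorem OKBefore.flag_mono (hh : Antitone h) (hr : ∀ c, h c ≤ r) {k : ℕ}
    (ht : OKBefore N h r t k) : Monotone fun c => flag N h t (remaining h r k c) c :=
  monotone_nat_of_le_succ fun c => ht.flag_le_succ hh hr c

theorem remaining_of_mem {k c i : ℕ} (hi : i < h c) (hk : c + r = k + i) :
    remaining h r k c = i + 1 := by
  rw [remaining]; lia

theorem remaining_pred (hh : Antitone h) {k c i : ℕ} (hi : i < h c) (hk : c + r = k + i)
    (hc : 0 < c) : remaining h r k (c - 1) = i := by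
  have := hh (Nat.sub_le c 1)
  rw [remaining]; lia

/-- The boxes on diagonal `k` in the columns from `j` on are compatible with their neighbours. -/
def OKFrom (N : ℕ) (h : ℕ → ℕ) (r : ℕ) (t : ℕ → ℕ → ℕ) (k j : ℕ) : Prop :=
  ∀ i c, j ≤ c → i < h c → c + r = k + i → LocallyOK N h t i c

/-- Such an entry is bounded below by the flag of the column to its left, which is at least the flag
of column `j` by monotonicity. This separates a newly extracted letter from the barred letters
waiting to its right. -/
theorem le_of_mem_diagFrom (hh : Antitone h) (hr : ∀ c, h c ≤ r) {k j : ℕ}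
    (ht : OKBefore N h r t k) (ht' : OKFrom N h r t k (j + 1)) {z : ℕ}
    (hz : z ∈ diagFrom h r l t k (j + 1)) : 2 * flag N h t (remaining h r k j) j ≤ z := by
  rw [diagFrom, List.mem_filterMap] at hz
  obtain ⟨c, hc, hz⟩ := hz
  rw [List.mem_range'_1] at hc
  split_ifs at hz with hp
  cases hz
  refine le_trans ?_ ((ht' _ c hc.1 hp.2 (by lia)).2 (by lia))
  have := ht.flag_mono hh hr (show j ≤ c - 1 by lia)
  simp only [remaining_pred hh hp.2 (show c + r = k + _ by lia) (by lia)] at this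
  lia

/-- Of two entries, the left one is bounded by the flag of the box below it, the right one by the
flag of the box to its left; monotone flags link the two bounds. -/
theorem pairwise_diagFrom (hh : Antitone h) (hr : ∀ c, h c ≤ r) {k j : ℕ}
    (ht : OKBefore N h r t k) (ht' : OKFrom N h r t k j) :
    (diagFrom h r l t k j).Pairwise fun x y => 2 * ((x + 1) / 2) ≤ y := by
  rw [diagFrom, List.pairwise_filterMap]
  refine (List.pairwise_lt_range' (s := j) (n := l - j)).imp_of_mem
    fun {c c'} hc hc' hlt x hx y hy => ?_
  rw [List.mem_range'_1] at hc hc'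
  split_ifs at hx with hp
  split_ifs at hy with hp'
  cases hx
  cases hy
  have h1 := (ht' _ c hc.1 hp.2 (by lia)).1
  have h2 := (ht' _ c' hc'.1 hp'.2 (by lia)).2 (by lia)
  have h3 := ht.flag_mono hh hr (show c ≤ c' - 1 by lia)
  simp only [remaining_pred hh hp'.2 (show c' + r = k + _ by lia) (by lia),
    remaining_of_mem hp.2 (show c + r = k + _ by lia)] at h3
  lia

end Peel

/-! ### Removing boxes and completing diagonals -/

section State

variable {R B : Type*} [Ring R] [Ring B]

/-- The row of column `c` if the boxes with diagonal index less than `k` are removed. -/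
def columnRow (φ : R →+* B) (ε : ℕ → B) (v : ℕ → R) (N : ℕ) (h : ℕ → ℕ) (r l : ℕ)
    (t : ℕ → ℕ → ℕ) (k c : ℕ) : B :=
  row φ ε v l (flag N h t (remaining h r k c) c) ((remaining h r k c : ℤ) - c)

/-- The product of the words of the diagonals with index less than `k`. -/
def wordsBelow (v : ℕ → R) (h : ℕ → ℕ) (r l : ℕ) (t : ℕ → ℕ → ℕ) (k : ℕ) : R :=
  ((List.range k).map fun k' => unbarredWord v (diagFrom h r l t k' 0) *
    barredWord v (diagFrom h r l t k' 0)).prod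

/-- The product of the rows of the columns after removing the diagonals with index less than `k`,
together with the words of these diagonals. -/
def diagState (φ : R →+* B) (ε : ℕ → B) (v : ℕ → R) (N : ℕ) (h : ℕ → ℕ) (r l : ℕ)
    (t : ℕ → ℕ → ℕ) (k : ℕ) : B :=
  φ (wordsBelow v h r l t k) * ((List.range l).map (columnRow φ ε v N h r l t k)).prod

/-- The state in which, moreover, the boxes of diagonal `k` in the columns from `j` on are removed;
the barred letters among them are still in front of column `j`. -/
def boxState (φ : R →+* B) (ε : ℕ → B) (v : ℕ → R) (N : ℕ) (h : ℕ → ℕ) (r l : ℕ)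
    (t : ℕ → ℕ → ℕ) (k j : ℕ) : B :=
  φ (wordsBelow v h r l t k) * φ (unbarredWord v (diagFrom h r l t k j)) *
    ((List.range j).map (columnRow φ ε v N h r l t k)).prod *
    (φ (barredWord v (diagFrom h r l t k j)) *
      ((List.range' j (l - j)).map (columnRow φ ε v N h r l t (k + 1))).prod)

variable {φ : R →+* B} {ε : ℕ → B} {v : ℕ → R} {N r l : ℕ} {h : ℕ → ℕ} {t : ℕ → ℕ → ℕ}

theorem unbarredWord_nil : unbarredWord v [] = 1 := by simp [unbarredWord]

theorem barredWord_nil : barredWord v [] = 1 := by simp [barredWord]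

theorem unbarredWord_cons_even {d : ℕ} (hd : Even d) (D : List ℕ) :
    unbarredWord v (d :: D) = unbarredWord v D * v d := by
  simp [unbarredWord, hd]

theorem unbarredWord_cons_odd {d : ℕ} (hd : Odd d) (D : List ℕ) :
    unbarredWord v (d :: D) = unbarredWord v D := by
  simp [unbarredWord, hd]

theorem barredWord_cons_even {d : ℕ} (hd : Even d) (D : List ℕ) :
    barredWord v (d :: D) = barredWord v D := by
  simp [barredWord, hd]

theorem barredWord_cons_odd {d : ℕ} (hd : Odd d) (D : List ℕ) :
    barredWord v (d :: D) = v d * barredWord v D := by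
  simp [barredWord, hd]

theorem boxState_right (k : ℕ) :
    boxState φ ε v N h r l t k l = diagState φ ε v N h r l t k := by
  simp [boxState, diagState, diagFrom_eq_nil, unbarredWord_nil, barredWord_nil]

theorem columnRow_congr {t t' : ℕ → ℕ → ℕ} {k c : ℕ}
    (htt : t (remaining h r k c) c = t' (remaining h r k c) c) :
    columnRow φ ε v N h r l t k c = columnRow φ ε v N h r l t' k c := by
  rw [columnRow, columnRow, flag_congr htt]

theorem columnRow_zero_left (hr : ∀ c, h c ≤ r) (c : ℕ) :
    columnRow φ ε v N h r l t 0 c = row φ ε v l N ((h c : ℤ) - c) := by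
  have h1 : remaining h r 0 c = h c := by have := hr c; rw [remaining]; lia
  rw [columnRow, h1, flag, if_neg (lt_irrefl _)]

theorem diagState_zero (hr : ∀ c, h c ≤ r) :
    diagState φ ε v N h r l t 0 =
      ((List.range l).map fun c => row φ ε v l N ((h c : ℤ) - c)).prod := by
  simp only [diagState, wordsBelow, List.range_zero, List.map_nil, List.prod_nil, map_one, one_mul]
  congr 1
  exact List.map_congr_left fun c _ => columnRow_zero_left hr c

theorem diagState_last (hε : WedgeBasis φ ε) :
    diagState φ ε v N h r l t (r + l) =
      φ (wordsBelow v h r l t (r + l)) * ((List.range l).map ε).prod := by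
  have h1 := hε.prod_rows_mul (v := v) le_rfl
    (fun c => flag N h t (remaining h r (r + l) c) c) (X := 1) (l := l) (by lia)
  rw [mul_one, mul_one] at h1
  rw [diagState, ← h1]
  congr 2
  refine List.map_congr_left fun c hc => ?_
  rw [List.mem_range] at hc
  have h2 : remaining h r (r + l) c = 0 := by rw [remaining]; lia
  rw [columnRow, h2]
  simp

/-- Nothing is removed from a column that does not meet the diagonal. -/
theorem boxState_of_le (hh : Antitone h) {k c : ℕ} (hc : c < l) (hk : h c + k ≤ c + r) :
    boxState φ ε v N h r l t k (c + 1) = boxState φ ε v N h r l t k c := by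
  have h1 : h (c + 1) + k ≤ c + 1 + r := by have := hh (Nat.le_succ c); lia
  have h2 : remaining h r k c = remaining h r (k + 1) c := by rw [remaining, remaining]; lia
  have h3 : columnRow φ ε v N h r l t (k + 1) c = columnRow φ ε v N h r l t k c := by
    rw [columnRow, columnRow, h2]
  rw [boxState, boxState, diagFrom_eq_nil_of_le hh hk, diagFrom_eq_nil_of_le hh h1,
    show l - c = l - (c + 1) + 1 by lia, List.range'_succ, List.range_succ, List.map_append,
    List.prod_append, barredWord_nil, unbarredWord_nil]
  simp [mul_assoc, h3]

/-- At the end of a diagonal the word of its barred letters moves to the front. -/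
theorem boxState_left (hε : WedgeBasis φ ε) {k : ℕ} (hk : k < r + l) :
    boxState φ ε v N h r l t k (k - r) = diagState φ ε v N h r l t (k + 1) := by
  have hdiag : diagFrom h r l t k 0 = diagFrom h r l t k (k - r) := by
    have (j : ℕ) (hj : j ≤ k - r) : diagFrom h r l t k 0 = diagFrom h r l t k j := by
      induction j with
      | zero => rfl
      | succ j ih =>
        rw [ih (by lia), diagFrom_eq (by lia), if_neg (by lia), List.nil_append]
    exact this _ le_rfl
  have hwords : wordsBelow v h r l t (k + 1) = wordsBelow v h r l t k *
      (unbarredWord v (diagFrom h r l t k (k - r)) *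
        barredWord v (diagFrom h r l t k (k - r))) := by
    rw [wordsBelow, wordsBelow, List.range_succ, List.map_append, List.prod_append, ← hdiag]
    simp
  have hrange : List.range l = List.range (k - r) ++ List.range' (k - r) (l - (k - r)) := by
    rw [List.range_eq_range', List.range_eq_range', show l = (k - r) + (l - (k - r)) by lia,
      ← List.range'_append_1]
    simp
  have hrow (k' : ℕ) (hk' : k ≤ k') : (List.range (k - r)).map (columnRow φ ε v N h r l t k') =
      (List.range (k - r)).map fun c => row φ ε v l (flag N h t 0 c) (-c) := by
    refine List.map_congr_left fun c hc => ?_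
    rw [List.mem_range] at hc
    have h2 : remaining h r k' c = 0 := by rw [remaining]; lia
    rw [columnRow, h2]
    simp
  rw [boxState, diagState, hwords, hrange, List.map_append, List.prod_append, hrow k le_rfl,
    hrow (k + 1) (by lia), map_mul, map_mul]
  rcases Nat.eq_zero_or_pos (k - r) with h0 | h0
  · rw [h0]; simp [mul_assoc]
  -- From column `k - r` on, every degree is at most `-(k - r)`, so these rows have no entries in
  -- earlier columns and use up all later generators.
  · have key := hε.prod_rows_mul_comm (v := v) (l := l) (j := k - r) (by lia)
      (fun c => flag N h t 0 c) (X := ((List.range' (k - r) (l - (k - r))).map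
        (columnRow φ ε v N h r l t (k + 1))).prod)
      (fun c hc hcl => hε.mul_rows_eq_zero _ (fun i hi hil => ⟨_, _, ?_, rfl⟩) hc hcl)
      (barredWord v (diagFrom h r l t k (k - r)))
    · rw [mul_assoc, key]
      simp only [mul_assoc]
    · rw [remaining]; lia

theorem wordsBelow_congr {t t' : ℕ → ℕ → ℕ} {k : ℕ}
    (htt : ∀ i c, c + r < k + i → t i c = t' i c) :
    wordsBelow v h r l t k = wordsBelow v h r l t' k := by
  rw [wordsBelow, wordsBelow]
  congr 1
  refine List.map_congr_left fun k' hk' => ?_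
  rw [List.mem_range] at hk'
  rw [diagFrom_congr fun i c _ hic => htt i c (by lia)]

/-- Removing one box from a column. -/
theorem boxState_eq_sum (hε : WedgeBasis φ ε) (hv : KronLetters v) (hh : Antitone h)
    (hr : ∀ c, h c ≤ r) {k c i : ℕ} (hc : c < l) (hi : i < h c) (hk : c + r = k + i)
    (ht : OKBefore N h r t k) (ht' : OKFrom N h r t k (c + 1)) :
    boxState φ ε v N h r l t k (c + 1) =
      ∑ d ∈ Finset.Ico (if c = 0 then 0 else 2 * flag N h t i (c - 1)) (2 * flag N h t (i + 1) c),
        boxState φ ε v N h r l (setEntry t i c d) k c := by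
  set m := flag N h t (i + 1) c with hm
  set n := if c = 0 then 0 else flag N h t i (c - 1) with hn
  set D := diagFrom h r l t k (c + 1) with hD
  set X := ((List.range' (c + 1) (l - (c + 1))).map (columnRow φ ε v N h r l t (k + 1))).prod
  set P := ((List.range c).map (columnRow φ ε v N h r l t k)).prod with hP
  have hrem : remaining h r k c = i + 1 := remaining_of_mem hi hk
  have hmono := ht.flag_mono hh hr
  have hnm : n ≤ m := by
    rcases Nat.eq_zero_or_pos c with h0 | h0
    · simp [hn, h0]
    · have h1 := hmono (Nat.sub_le c 1)
      simp only [hrem, remaining_pred hh hi hk h0] at h1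
      rw [hn, if_neg h0.ne']
      exact h1
  have hn2 : (if c = 0 then 0 else 2 * flag N h t i (c - 1)) = 2 * n := by
    rw [hn]; split_ifs <;> simp
  have hDm : ∀ z ∈ D, 2 * m ≤ z := fun z hz => by
    have := le_of_mem_diagFrom hh hr ht ht' hz
    rwa [hrem] at this
  have hDp : D.Pairwise fun x y => 2 * ((x + 1) / 2) ≤ y := pairwise_diagFrom hh hr ht ht'
  have hstate (d : ℕ) : boxState φ ε v N h r l (setEntry t i c d) k c =
      φ (wordsBelow v h r l t k) * φ (unbarredWord v (d :: D)) * P *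
        (φ (barredWord v (d :: D)) * (row φ ε v l ((d + 1) / 2) ((i : ℤ) - c) * X)) := by
    have e1 : diagFrom h r l (setEntry t i c d) k c = d :: D := by
      rw [diagFrom_eq hc, if_pos (by lia), show c + r - k = i by lia,
        diagFrom_congr fun i' c' hc' _ => setEntry_of_ne t d (i := i) (c := c) (by lia)]
      simp [setEntry, hD]
    have e2 : wordsBelow v h r l (setEntry t i c d) k = wordsBelow v h r l t k :=
      wordsBelow_congr fun i' c' hc' => setEntry_of_ne t d (by lia)
    have e3 : (List.range c).map (columnRow φ ε v N h r l (setEntry t i c d) k) =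
        (List.range c).map (columnRow φ ε v N h r l t k) := by
      refine List.map_congr_left fun c' hc' => columnRow_congr (setEntry_of_ne t d ?_)
      rw [List.mem_range] at hc'
      lia
    have e4 : (List.range' (c + 1) (l - (c + 1))).map
        (columnRow φ ε v N h r l (setEntry t i c d) (k + 1)) =
        (List.range' (c + 1) (l - (c + 1))).map (columnRow φ ε v N h r l t (k + 1)) := by
      refine List.map_congr_left fun c' hc' => columnRow_congr (setEntry_of_ne t d ?_)
      rw [List.mem_range'_1] at hc'
      lia
    have e5 : remaining h r (k + 1) c = i := by rw [remaining]; lia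
    have e6 : columnRow φ ε v N h r l (setEntry t i c d) (k + 1) c =
        row φ ε v l ((d + 1) / 2) ((i : ℤ) - c) := by
      rw [columnRow, e5, flag, if_pos hi]
      simp [setEntry]
    rw [boxState, e1, e2, e3, show l - c = l - (c + 1) + 1 by lia, List.range'_succ, List.map_cons,
      List.prod_cons, e4, e6]
  -- For `c > 0` this row equals the last factor of `P`: column `c - 1` has `i` boxes left, hence
  -- the same degree, and its flag is `n`. For `c = 0` there are no letters and the degrees are
  -- positive.
  have hzero : P * row φ ε v l n (((i + 1 : ℕ) : ℤ) - c) = 0 := by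
    rcases Nat.eq_zero_or_pos c with h0 | h0
    · rw [hn, if_pos h0, row_zero _ (by lia), mul_zero]
    · have e : columnRow φ ε v N h r l t k (c - 1) = row φ ε v l n (((i + 1 : ℕ) : ℤ) - c) := by
        rw [columnRow, remaining_pred hh hi hk h0, hn, if_neg h0.ne']
        congr 1
        lia
      rw [hP, show c = c - 1 + 1 by lia, List.range_succ, List.map_append, List.prod_append,
        mul_assoc]
      simp only [List.map_cons, List.map_nil, List.prod_cons, List.prod_nil, mul_one]
      rw [e, show ((c - 1 + 1 : ℕ) : ℤ) = c by lia, row_mul_self hε hv, mul_zero]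
  have hstart : boxState φ ε v N h r l t k (c + 1) =
      φ (wordsBelow v h r l t k) * φ (unbarredWord v D) *
        (P * row φ ε v l m (((i + 1 : ℕ) : ℤ) - c)) * (φ (barredWord v D) * X) := by
    rw [boxState, List.range_succ, List.map_append, List.prod_append]
    simp only [List.map_cons, List.map_nil, List.prod_cons, List.prod_nil, mul_one]
    rw [show columnRow φ ε v N h r l t k c = row φ ε v l m (((i + 1 : ℕ) : ℤ) - c) by
      rw [columnRow, hrem]]
  rw [hstart, row_eq_add_sum hnm, mul_add, hzero, zero_add, Finset.mul_sum, Finset.mul_sum,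
    Finset.sum_mul, hn2]
  refine Finset.sum_congr rfl fun d hd => ?_
  rw [Finset.mem_Ico] at hd
  rw [hstate, show ((i + 1 : ℕ) : ℤ) - c - 1 = (i : ℤ) - c by push_cast; ring]
  rcases Nat.even_or_odd' d with ⟨e, rfl | rfl⟩
  · rw [show (2 * e + 1) / 2 = e by lia, unbarredWord_cons_even (by simp),
      barredWord_cons_even (by simp)]
    -- The waiting letters are odd and at least `2 * m`, while `2 * e < 2 * m`; so they exceed `2 *
    -- e + 1` and are far from this row.
    have hcomm : row φ ε v l e ((i : ℤ) - c) * φ (barredWord v D) =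
        φ (barredWord v D) * row φ ε v l e ((i : ℤ) - c) := by
      refine row_mul_word_far hε hv _ _ fun z hz => ?_
      have h1 := hDm z (List.mem_of_mem_filter hz)
      obtain ⟨q, hq⟩ : Odd z := by simpa using (List.mem_filter.1 hz).2
      lia
    -- All columns left of `c` are already cut by earlier diagonals, so consecutive degrees agree,
    -- or drop by one between empty columns. The first error row would coincide with the new row of
    -- column `c`.
    have hmove := prod_rows_mul_unbarred hε hv (l := l)
      (fun c => flag N h t (remaining h r k c) c) (fun c => (remaining h r k c : ℤ) - c) e c
      (fun j _ => hmono (Nat.le_succ j)) (fun j hj => ?_) (fun j hj => ?_)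
      (row φ ε v l e ((i : ℤ) - c) * (φ (barredWord v D) * X)) (fun h0 _ => ?_)
    · change P * _ = _ * (P * _) at hmove
      rw [map_mul]
      simp only [mul_assoc]
      rw [hmove, ← mul_assoc (row _ _ _ _ _ _), hcomm, mul_assoc]
    · refine le_trans (hmono (show j ≤ c - 1 by lia)) ?_
      simp only [remaining_pred hh hi hk (show 0 < c by lia)]
      rw [hn, if_neg (by lia)] at hd
      lia
    · have h1 := hh (Nat.le_succ j)
      have h2 := hh (show j + 1 ≤ c by lia)
      simp only [remaining]
      lia
    · rw [remaining_pred hh hi hk h0, show (i : ℤ) - ((c - 1 : ℕ) : ℤ) - 1 = (i : ℤ) - c by lia,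
        ← mul_assoc, row_mul_self hε hv, zero_mul]
  · rw [show (2 * e + 1 + 1) / 2 = e + 1 by lia, unbarredWord_cons_odd (by simp),
      barredWord_cons_odd (by simp), map_mul]
    -- The extracted barred letter stays in front of column `c`, and the waiting barred word joins
    -- it there, which prepends the new letter to the word.
    have hcomm := barred_mul_row_mul_word (l := l) hε hv e ((i : ℤ) - c)
      (D.filter fun x => Odd x) (fun z hz => by simpa using (List.mem_filter.1 hz).2)
      (fun z hz => by have := hDm z (List.mem_of_mem_filter hz); lia)
      (hDp.sublist List.filter_sublist)
    change _ * φ (barredWord v D) = _ * φ (barredWord v D) * _ at hcomm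
    simp only [← mul_assoc] at hcomm ⊢
    simp only [mul_assoc] at hcomm ⊢
    have hcomm' := congrArg (· * X) hcomm
    simp only [mul_assoc] at hcomm'
    rw [hcomm']

end State

/-! ### Sums over fillings with prescribed entries -/

section Fillings

open Classical in
/-- The functions with values below `M` that agree with `T` where `p` holds, and satisfy a local
condition elsewhere. -/
noncomputable def fillings {ι : Type*} [Fintype ι] (M : ℕ) (OK : (ι → ℕ) → ι → Prop)
    (p : ι → Prop) (T : ι → ℕ) : Finset (ι → ℕ) :=
  (Fintype.piFinset fun x => if p x then {T x} else Finset.range M).filter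
    fun T' => ∀ x, ¬ p x → OK T' x

variable {ι : Type*} [Fintype ι] {M : ℕ} {OK : (ι → ℕ) → ι → Prop} {p : ι → Prop} {T : ι → ℕ}

theorem mem_fillings {T' : ι → ℕ} : T' ∈ fillings M OK p T ↔
    (∀ x, p x → T' x = T x) ∧ ∀ x, ¬ p x → T' x < M ∧ OK T' x := by
  simp only [fillings, Finset.mem_filter, Fintype.mem_piFinset]
  constructor
  · rintro ⟨h1, h2⟩
    refine ⟨fun x hx => ?_, fun x hx => ⟨?_, h2 x hx⟩⟩
    · have := h1 x; rw [if_pos hx] at this; simpa using this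
    · have := h1 x; rw [if_neg hx] at this; simpa using this
  · rintro ⟨h1, h2⟩
    refine ⟨fun x => ?_, fun x hx => (h2 x hx).2⟩
    split_ifs with hx
    · simpa using h1 x hx
    · simpa using (h2 x hx).1

theorem fillings_congr {q : ι → Prop} (h : ∀ x, p x ↔ q x) :
    fillings M OK p T = fillings M OK q T := by
  rw [show p = q from funext fun x => propext (h x)]

theorem fillings_of_forall (h : ∀ x, p x) : fillings M OK p T = {T} := by
  ext T'
  simp only [mem_fillings, Finset.mem_singleton, h, funext_iff]
  simp

/-- Summation over the value at one further place. -/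
theorem sum_fillings [DecidableEq ι] {A : Type*} [AddCommMonoid A] (G : (ι → ℕ) → A) {x : ι}
    (hx : ¬ p x) {a b : ℕ} (hb : b ≤ M)
    (hOK : ∀ T', (∀ y, p y → T' y = T y) → (OK T' x ↔ T' x ∈ Finset.Ico a b)) :
    ∑ T' ∈ fillings M OK p T, G T' =
      ∑ d ∈ Finset.Ico a b, ∑ T' ∈ fillings M OK (fun y => p y ∨ y = x) (Function.update T x d),
        G T' := by
  rw [← Finset.sum_fiberwise_of_maps_to (t := Finset.Ico a b) (g := fun T' => T' x)]
  · refine Finset.sum_congr rfl fun d hd => Finset.sum_congr ?_ fun _ _ => rfl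
    ext T'
    simp only [Finset.mem_filter, mem_fillings, not_or]
    constructor
    · rintro ⟨⟨h1, h2⟩, rfl⟩
      refine ⟨fun y hy => ?_, fun y hy => h2 y hy.1⟩
      rcases eq_or_ne y x with rfl | hyx
      · simp
      · rw [Function.update_of_ne hyx, h1 y (hy.resolve_right hyx)]
    · rintro ⟨h1, h2⟩
      have h3 : T' x = d := by simpa using h1 x (Or.inr rfl)
      have h4 : ∀ y, p y → T' y = T y := fun y hy => by
        rw [h1 y (Or.inl hy), Function.update_of_ne]
        rintro rfl
        exact hx hy
      refine ⟨⟨h4, fun y hy => ?_⟩, h3⟩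
      rcases eq_or_ne y x with rfl | hyx
      · rw [hOK T' h4, h3]
        exact ⟨(Finset.mem_Ico.1 hd).2.trans_le hb, hd⟩
      · exact h2 y ⟨hy, hyx⟩
  · intro T' hT'
    rw [mem_fillings] at hT'
    exact (hOK T' hT'.1).1 (hT'.2 x hx).2

end Fillings

section Entries

variable {ν : YoungDiagram}

/-- The entries of a filling, extended by zero. -/
def entries (T : ν.cells → ℕ) (i c : ℕ) : ℕ :=
  if hic : (i, c) ∈ ν.cells then T ⟨(i, c), hic⟩ else 0

theorem entries_apply (T : ν.cells → ℕ) (x : ν.cells) : entries T x.1.1 x.1.2 = T x :=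
  dif_pos x.2

theorem entries_update (T : ν.cells → ℕ) (x : ν.cells) (d : ℕ) :
    entries (Function.update T x d) = setEntry (entries T) x.1.1 x.1.2 d := by
  funext i c
  rw [setEntry]
  split_ifs with h
  · rw [h.1, h.2, entries_apply, Function.update_self]
  · rw [entries, entries]
    split_ifs with hic
    · rw [Function.update_of_ne]
      rintro rfl
      exact h ⟨rfl, rfl⟩
    · rfl

theorem mem_cells_iff {i c : ℕ} : (i, c) ∈ ν.cells ↔ i < ν.colLen c := by
  rw [YoungDiagram.mem_cells, YoungDiagram.mem_iff_lt_colLen]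

theorem colLen_antitone : Antitone ν.colLen := fun _ _ h => ν.colLen_anti _ _ h

theorem colLen_le (c : ℕ) : ν.colLen c ≤ ν.colLen 0 := colLen_antitone (Nat.zero_le c)

theorem lt_rowLen_of_lt_colLen {i c : ℕ} (h : i < ν.colLen c) : c < ν.rowLen 0 := by
  rw [← YoungDiagram.mem_iff_lt_colLen, YoungDiagram.mem_iff_lt_rowLen] at h
  exact h.trans_le (ν.rowLen_anti _ _ (Nat.zero_le i))

theorem LocallyOK.congr {N : ℕ} {h : ℕ → ℕ} {t t' : ℕ → ℕ → ℕ} {i c : ℕ} (h0 : t i c = t' i c)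
    (h1 : t (i + 1) c = t' (i + 1) c) (h2 : 0 < c → t i (c - 1) = t' i (c - 1)) :
    LocallyOK N h t i c ↔ LocallyOK N h t' i c := by
  rw [LocallyOK, LocallyOK, h0, flag_congr h1]
  refine and_congr_right fun _ => imp_congr_right fun hc => ?_
  rw [flag_congr (h2 hc)]

theorem locallyOK_iff_mem_Ico {N : ℕ} {h : ℕ → ℕ} {t : ℕ → ℕ → ℕ} {i c : ℕ} :
    LocallyOK N h t i c ↔ t i c ∈
      Finset.Ico (if c = 0 then 0 else 2 * flag N h t i (c - 1)) (2 * flag N h t (i + 1) c) := by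
  rw [LocallyOK, Finset.mem_Ico]
  rcases Nat.eq_zero_or_pos c with h0 | h0
  · simp [h0]
  · simp [h0, h0.ne', and_comm]

end Entries

/-! ### Expansion of the product of rows over all fillings -/

section Expansion

variable {R B : Type*} [Ring R] [Ring B] {φ : R →+* B} {ε : ℕ → B} {v : ℕ → R} {N : ℕ}
  {ν : YoungDiagram}

/-- Compatibility of an entry of a filling of `ν` with its neighbours. -/
def EntryOK (N : ℕ) {ν : YoungDiagram} (T : ν.cells → ℕ) (x : ν.cells) : Prop :=
  LocallyOK N ν.colLen (entries T) x.1.1 x.1.2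

/-- The boxes of diagonal `k` from column `j` on are already filled by `T`. Induction on `j` peels
the remaining ones; the base `j = k - r`, with `r` the number of rows of `ν`, is the completed
diagonal, where `IH` takes over for diagonal `k + 1`. -/
theorem boxState_eq_sum_fillings (hε : WedgeBasis φ ε) (hv : KronLetters v) {k : ℕ}
    (hk : k < ν.colLen 0 + ν.rowLen 0) (G : (ν.cells → ℕ) → B)
    (IH : ∀ T : ν.cells → ℕ, OKBefore N ν.colLen (ν.colLen 0) (entries T) (k + 1) →
      diagState φ ε v N ν.colLen (ν.colLen 0) (ν.rowLen 0) (entries T) (k + 1) =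
        ∑ T' ∈ fillings (2 * N) (EntryOK N)
          (fun x => x.1.2 + ν.colLen 0 < k + 1 + x.1.1) T, G T')
    {j : ℕ} (hj : k - ν.colLen 0 ≤ j) (hjl : j ≤ ν.rowLen 0) (T : ν.cells → ℕ)
    (hT : OKBefore N ν.colLen (ν.colLen 0) (entries T) k)
    (hT' : OKFrom N ν.colLen (ν.colLen 0) (entries T) k j) :
    boxState φ ε v N ν.colLen (ν.colLen 0) (ν.rowLen 0) (entries T) k j =
      ∑ T' ∈ fillings (2 * N) (EntryOK N)
        (fun x => x.1.2 + ν.colLen 0 < k + x.1.1 ∨ x.1.2 + ν.colLen 0 = k + x.1.1 ∧ j ≤ x.1.2) T,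
        G T' := by
  induction j, hj using Nat.le_induction generalizing T with
  | base =>
    rw [boxState_left hε hk, IH T, fillings_congr fun x => ?_]
    · lia
    · intro i c hi hc
      by_cases hcase : c + ν.colLen 0 < k + i
      · exact hT i c hi hcase
      · exact hT' i c (by lia) hi (by lia)
  | succ c hc ih =>
    by_cases hcol : ν.colLen c + k ≤ c + ν.colLen 0
    · rw [boxState_of_le colLen_antitone (by lia) hcol, ih (by lia) T hT fun i c' hc' hi hic => ?_,
        fillings_congr fun x => ?_]
      · have hx := mem_cells_iff.1 x.2
        rcases eq_or_ne x.1.2 c with h | h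
        · rw [h] at hx; lia
        · lia
      · rcases eq_or_ne c' c with rfl | h
        · lia
        · exact hT' i c' (by lia) hi hic
    · obtain ⟨i, hi⟩ : ∃ i, c + ν.colLen 0 = k + i := ⟨c + ν.colLen 0 - k, by lia⟩
      have hic : i < ν.colLen c := by lia
      set x : ν.cells := ⟨(i, c), mem_cells_iff.2 hic⟩ with hx
      rw [boxState_eq_sum hε hv colLen_antitone colLen_le (by lia) hic hi hT hT',
        sum_fillings (x := x) (a := if c = 0 then 0 else
          2 * flag N ν.colLen (entries T) i (c - 1))
          (b := 2 * flag N ν.colLen (entries T) (i + 1) c)]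
      · refine Finset.sum_congr rfl fun d hd => ?_
        rw [← entries_update T x d, ih (by lia), fillings_congr fun y => ?_]
        · rw [Subtype.ext_iff, Prod.ext_iff]
          simp only [hx]
          lia
        · intro i' c' hi' hc'
          rw [entries_update]
          refine (LocallyOK.congr ?_ ?_ fun _ => ?_).1 (hT i' c' hi' hc') <;>
            exact (setEntry_of_ne _ d (by lia)).symm
        · intro i' c' hcc' hi' hc'
          rw [entries_update]
          rcases hcc'.eq_or_lt with rfl | hlt
          · obtain rfl : i' = i := by lia
            rw [locallyOK_iff_mem_Ico, setEntry_self]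
            rw [flag_congr (setEntry_of_ne (entries T) (i := i') (c := c) d (i' := i' + 1) (c' := c)
              (by lia))]
            by_cases h0 : c = 0
            · simpa [h0] using hd
            · rw [flag_congr (setEntry_of_ne (entries T) (i := i') (c := c) d (i' := i')
                (c' := c - 1) (by lia))]
              exact hd
          · refine (LocallyOK.congr ?_ ?_ fun _ => ?_).1 (hT' i' c' hlt hi' hc') <;>
              exact (setEntry_of_ne _ d (by lia)).symm
      · simp only [hx]
        lia
      · exact Nat.mul_le_mul_left 2 (flag_le fun hs => hT.lt hs (by lia))
      · intro T' hTT'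
        -- The interval of admissible values depends only on the boxes below and to the left, which
        -- lie on diagonal `k - 1` and are already fixed.
        have hagree (i' c' : ℕ) (hc' : c' + ν.colLen 0 < k + i') :
            entries T' i' c' = entries T i' c' := by
          rw [entries, entries]
          split_ifs with hmem
          · exact hTT' _ (Or.inl hc')
          · rfl
        rw [EntryOK, locallyOK_iff_mem_Ico, entries_apply]
        simp only [hx]
        rw [flag_congr (hagree (i + 1) c (by lia))]
        by_cases h0 : c = 0
        · simp [h0]
        · rw [flag_congr (hagree i (c - 1) (by lia))]

theorem diagState_eq_sum_fillings (hε : WedgeBasis φ ε) (hv : KronLetters v) {k : ℕ}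
    (hk : k ≤ ν.colLen 0 + ν.rowLen 0) (T : ν.cells → ℕ)
    (hT : OKBefore N ν.colLen (ν.colLen 0) (entries T) k) :
    diagState φ ε v N ν.colLen (ν.colLen 0) (ν.rowLen 0) (entries T) k =
      ∑ T' ∈ fillings (2 * N) (EntryOK N) (fun x => x.1.2 + ν.colLen 0 < k + x.1.1) T,
        φ (wordsBelow v ν.colLen (ν.colLen 0) (ν.rowLen 0) (entries T')
          (ν.colLen 0 + ν.rowLen 0)) * ((List.range (ν.rowLen 0)).map ε).prod := by
  induction hk using Nat.decreasingInduction generalizing T with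
  | self =>
    rw [fillings_of_forall fun x => ?_, Finset.sum_singleton, diagState_last hε]
    have := lt_rowLen_of_lt_colLen (mem_cells_iff.1 x.2)
    lia
  | of_succ k hk ih =>
    rw [← boxState_right, boxState_eq_sum_fillings hε hv hk _ ih (by lia) le_rfl T hT,
      fillings_congr fun x => ?_]
    · have := lt_rowLen_of_lt_colLen (mem_cells_iff.1 x.2)
      lia
    · intro i c hc hi
      have := lt_rowLen_of_lt_colLen hi
      lia

/-- The expansion of the product of all rows. -/
theorem prod_rows_eq_sum (hε : WedgeBasis φ ε) (hv : KronLetters v) :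
    ((List.range (ν.rowLen 0)).map fun c =>
        row φ ε v (ν.rowLen 0) N ((ν.colLen c : ℤ) - c)).prod =
      φ (∑ T ∈ fillings (2 * N) (EntryOK N) (fun _ : ν.cells => False) 0,
        wordsBelow v ν.colLen (ν.colLen 0) (ν.rowLen 0) (entries T)
          (ν.colLen 0 + ν.rowLen 0)) * ((List.range (ν.rowLen 0)).map ε).prod := by
  have hlt (i c : ℕ) (hi : i < ν.colLen c) (hc : c + ν.colLen 0 < 0 + i) : False := by
    have := colLen_le (ν := ν) c
    lia
  rw [map_sum, Finset.sum_mul, ← diagState_zero colLen_le (t := entries (0 : ν.cells → ℕ)),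
    diagState_eq_sum_fillings hε hv (Nat.zero_le _) 0 fun i c hi hc => (hlt i c hi hc).elim,
    fillings_congr fun x => ?_]
  exact ⟨fun h => hlt _ _ (mem_cells_iff.1 x.2) h, False.elim⟩

end Expansion

open scoped TensorProduct

/-! ### The determinant as the coefficient of the top form -/

section Exterior

variable (R : Type*) [Ring R] (l : ℕ)

/-- The exterior algebra on `l` generators with coefficients in `R`. -/
abbrev CoeffExterior : Type _ := R ⊗[ℤ] ExteriorAlgebra ℤ (Fin l → ℤ)

/-- The coefficients in the exterior algebra. -/
def coeffHom : R →+* CoeffExterior R l := Algebra.TensorProduct.includeLeftRingHom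

/-- The vectors of the standard basis, and zero for larger indices. -/
def stdVector (c : ℕ) : Fin l → ℤ := fun i => if (i : ℕ) = c then 1 else 0

/-- The generators of the exterior algebra. -/
noncomputable def wedgeGen (c : ℕ) : CoeffExterior R l :=
  1 ⊗ₜ ExteriorAlgebra.ι ℤ (stdVector l c)

theorem wedgeBasis : WedgeBasis (coeffHom R l) (wedgeGen R l) where
  comm r c := by
    simp [coeffHom, wedgeGen, Algebra.TensorProduct.tmul_mul_tmul]
  sq c := by
    simp [wedgeGen, Algebra.TensorProduct.tmul_mul_tmul]
  anticomm c d := by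
    rw [wedgeGen, wedgeGen, Algebra.TensorProduct.tmul_mul_tmul,
      Algebra.TensorProduct.tmul_mul_tmul, ← TensorProduct.tmul_neg,
      eq_neg_of_add_eq_zero_left (ExteriorAlgebra.ι_add_mul_swap _ _)]

variable {R l}

theorem prod_ofFn_tmul {S : Type*} [Ring S] (n : ℕ) (a : Fin n → R) (b : Fin n → S) :
    (List.ofFn fun i => a i ⊗ₜ[ℤ] b i).prod = (List.ofFn a).prod ⊗ₜ (List.ofFn b).prod := by
  induction n with
  | zero => simp [Algebra.TensorProduct.one_def]
  | succ n ih =>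
    rw [List.ofFn_succ, List.ofFn_succ, List.ofFn_succ, List.prod_cons, List.prod_cons,
      List.prod_cons, ih, Algebra.TensorProduct.tmul_mul_tmul]

theorem map_range_eq_ofFn {α : Type*} (f : ℕ → α) (n : ℕ) :
    (List.range n).map f = List.ofFn fun i : Fin n => f i := by
  refine List.ext_getElem (by simp) fun i _ _ => by simp

theorem coeffHom_mul_prod_wedgeGen (r : R) :
    coeffHom R l r * ((List.range l).map (wedgeGen R l)).prod =
      r ⊗ₜ ExteriorAlgebra.ιMulti ℤ l fun i : Fin l => stdVector l i := by
  rw [map_range_eq_ofFn]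
  simp only [wedgeGen]
  rw [prod_ofFn_tmul, ExteriorAlgebra.ιMulti_apply, coeffHom]
  simp [Algebra.TensorProduct.tmul_mul_tmul]

/-- The product of the rows of a matrix is its determinant times the top form. -/
theorem prod_rows_eq_det (a : Fin l → Fin l → R) :
    (List.ofFn fun i => ∑ c, coeffHom R l (a i c) * wedgeGen R l c).prod =
      coeffHom R l (∑ π : Equiv.Perm (Fin l),
        (Equiv.Perm.sign π : ℤ) • (List.ofFn fun i => a i (π i)).prod) *
      ((List.range l).map (wedgeGen R l)).prod := by
  have h1 (i c : Fin l) : coeffHom R l (a i c) * wedgeGen R l c =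
      a i c ⊗ₜ ExteriorAlgebra.ι ℤ (stdVector l c) := by
    simp [coeffHom, wedgeGen, Algebra.TensorProduct.tmul_mul_tmul]
  simp only [h1]
  have h2 := MultilinearMap.map_sum (MultilinearMap.mkPiAlgebraFin ℤ l (CoeffExterior R l))
    fun i c : Fin l => a i c ⊗ₜ[ℤ] ExteriorAlgebra.ι ℤ (stdVector l (c : ℕ))
  simp only [MultilinearMap.mkPiAlgebraFin_apply, prod_ofFn_tmul] at h2
  rw [h2, coeffHom_mul_prod_wedgeGen, TensorProduct.sum_tmul]
  symm
  refine Finset.sum_of_injOn (fun π : Equiv.Perm (Fin l) => ⇑π) ?_ (by simp) ?_ ?_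
  · exact fun π _ σ _ h => DFunLike.coe_injective h
  -- A choice of columns that is not a permutation repeats a basis vector, so its wedge product
  -- vanishes.
  · intro f _ hf
    have hinj : ¬ Function.Injective f := fun hinj => hf ⟨Equiv.ofBijective f
      ⟨hinj, Finite.surjective_of_injective hinj⟩, by simp, rfl⟩
    rw [← ExteriorAlgebra.ιMulti_apply (v := fun i => stdVector l (f i)),
      AlternatingMap.map_eq_zero_of_not_injective, TensorProduct.tmul_zero]
    exact fun h => hinj fun i j hij => h (by simp [hij])
  · intro π _
    have := AlternatingMap.map_perm (ExteriorAlgebra.ιMulti ℤ l)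
      (fun i : Fin l => stdVector l i) π
    rw [← ExteriorAlgebra.ιMulti_apply (v := fun i => stdVector l (π i))]
    change ExteriorAlgebra.ιMulti ℤ l (fun i => stdVector l (π i)) = _ at this
    rw [this, TensorProduct.smul_tmul]
    rfl

theorem stdVector_eq_one : (fun i : Fin l => stdVector l i) = (1 : Matrix (Fin l) (Fin l) ℤ) := by
  funext i j
  simp [stdVector, Matrix.one_apply, Fin.ext_iff, eq_comm]

/-- The coefficient of the top form is determined. -/
theorem coeff_top_injective {r s : R}
    (h : coeffHom R l r * ((List.range l).map (wedgeGen R l)).prod =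
      coeffHom R l s * ((List.range l).map (wedgeGen R l)).prod) : r = s := by
  -- The determinant is a linear functional with value 1 on the top form; tensored with `R`, it
  -- reads off the coefficient.
  let τ : ExteriorAlgebra ℤ (Fin l → ℤ) →ₗ[ℤ] ℤ :=
    ExteriorAlgebra.liftAlternating (Pi.single l Matrix.detRowAlternating)
  have hτ : τ (ExteriorAlgebra.ιMulti ℤ l fun i : Fin l => stdVector l i) = 1 := by
    rw [ExteriorAlgebra.liftAlternating_apply_ιMulti, Pi.single_eq_same, stdVector_eq_one]
    exact Matrix.det_one
  rw [coeffHom_mul_prod_wedgeGen, coeffHom_mul_prod_wedgeGen] at h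
  have := congrArg (fun x => TensorProduct.rid ℤ R (τ.lTensor R x)) h
  simpa [hτ] using this

/-- The determinant of elementary symmetric functions as a sum over fillings. -/
theorem det_elemBelow_eq_sum {v : ℕ → R} (hv : KronLetters v) (N : ℕ) (ν : YoungDiagram) :
    ∑ π : Equiv.Perm (Fin (ν.rowLen 0)), (Equiv.Perm.sign π : ℤ) •
      (List.ofFn fun i : Fin (ν.rowLen 0) => elemBelow v (2 * N)
        ((ν.colLen i : ℤ) - (i : ℕ) + ((π i : ℕ) : ℤ))).prod =
      ∑ T ∈ fillings (2 * N) (EntryOK N) (fun _ : ν.cells => False) 0,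
        wordsBelow v ν.colLen (ν.colLen 0) (ν.rowLen 0) (entries T)
          (ν.colLen 0 + ν.rowLen 0) := by
  refine coeff_top_injective (l := ν.rowLen 0) ?_
  rw [← prod_rows_eq_det fun i c => elemBelow v (2 * N)
    ((ν.colLen i : ℤ) - (i : ℕ) + ((c : ℕ) : ℤ)),
    ← prod_rows_eq_sum (wedgeBasis R (ν.rowLen 0)) hv, map_range_eq_ofFn]
  simp only [row, Finset.sum_range]

end Exterior

/-! ### Letters as natural numbers -/

section Letters

variable {N : ℕ}

/-- The position of a letter in the natural order. -/
def letterIdx (x : Letter N) : ℕ := 2 * (ofLex x).1.val + if (ofLex x).2 then 1 else 0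

/-- The letter at a given position. -/
def letterOf (n : ℕ) (hn : n < 2 * N) : Letter N := toLex (⟨n / 2, by lia⟩, decide (n % 2 = 1))

theorem letterIdx_lt (x : Letter N) : letterIdx x < 2 * N := by
  have := (ofLex x).1.isLt
  rw [letterIdx]; split_ifs <;> lia

theorem letterIdx_letterOf (n : ℕ) (hn : n < 2 * N) : letterIdx (letterOf n hn) = n := by
  simp only [letterIdx, letterOf, ofLex_toLex, decide_eq_true_eq]
  split_ifs <;> lia

theorem letterIdx_injective : Function.Injective (letterIdx (N := N)) := by
  intro x y hxy
  rw [letterIdx, letterIdx] at hxy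
  refine ofLex.injective (Prod.ext (Fin.ext ?_) ?_)
  · split_ifs at hxy <;> lia
  · cases h1 : (ofLex x).2 <;> cases h2 : (ofLex y).2 <;> simp [h1, h2] at hxy ⊢ <;> lia

theorem letterOf_letterIdx (x : Letter N) : letterOf (letterIdx x) (letterIdx_lt x) = x :=
  letterIdx_injective (letterIdx_letterOf _ _)

theorem barred_iff (x : Letter N) : Barred x ↔ Odd (letterIdx x) := by
  rw [Barred, letterIdx]
  cases (ofLex x).2 <;> simp

theorem letterIdx_strictMono : StrictMono (letterIdx (N := N)) := by
  intro x y hxy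
  rw [Prod.Lex.lt_iff] at hxy
  rw [letterIdx, letterIdx]
  rcases hxy with h | ⟨h1, h2⟩
  · have : (ofLex x).1.val < (ofLex y).1.val := h
    split_ifs <;> lia
  · rw [h1]
    cases h3 : (ofLex x).2 <;> cases h4 : (ofLex y).2 <;> simp [h3, h4] at h2 ⊢
    exact absurd h2 (by decide)

theorem letterIdx_lt_iff {x y : Letter N} : letterIdx x < letterIdx y ↔ x < y :=
  letterIdx_strictMono.lt_iff_lt

theorem letterIdx_le_iff {x y : Letter N} : letterIdx x ≤ letterIdx y ↔ x ≤ y :=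
  letterIdx_strictMono.le_iff_le

theorem down_letterOf {n : ℕ} (hn : n + 1 < 2 * N) :
    down (letterOf (n + 1) hn) = some (letterOf n (by lia)) := by
  have hidx : letterIdx (letterOf (n + 1) hn) = n + 1 := letterIdx_letterOf _ _
  rw [down]
  by_cases hb : Barred (letterOf (n + 1) hn)
  · rw [if_pos hb]
    rw [barred_iff, hidx] at hb
    refine congrArg some (letterIdx_injective ?_)
    rw [letterIdx_letterOf]
    simp only [letterIdx, unbar, letterOf, ofLex_toLex]
    obtain ⟨q, hq⟩ := hb
    simp
    lia
  · rw [if_neg hb]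
    rw [barred_iff, hidx, Nat.not_odd_iff_even] at hb
    obtain ⟨q, hq⟩ := hb
    rw [if_pos (by simp only [letterOf, ofLex_toLex]; lia)]
    refine congrArg some (letterIdx_injective ?_)
    rw [letterIdx_letterOf]
    simp only [letterIdx, bar, letterOf, ofLex_toLex]
    simp
    lia

theorem downTwo_letterOf {n : ℕ} (hn : n + 2 < 2 * N) :
    downTwo (letterOf (n + 2) hn) = some (letterOf n (by lia)) := by
  rw [downTwo, down_letterOf, Option.bind_some, down_letterOf]

/-- The image in the quotient of the letter at a position, or zero if there is none. -/
def letterVar (N n : ℕ) : UKron N := if hn : n < 2 * N then toUKron N (u (letterOf n hn)) else 0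

theorem letterVar_letterIdx (x : Letter N) : letterVar N (letterIdx x) = toUKron N (u x) := by
  rw [letterVar, dif_pos (letterIdx_lt x), letterOf_letterIdx]

theorem toUKron_rel {a b : U N} (h : KronRel N a b) : toUKron N a = toUKron N b :=
  RingQuot.mkRingHom_rel h

theorem letterVar_of_lt {n : ℕ} (hn : n < 2 * N) :
    letterVar N n = toUKron N (u (letterOf n hn)) := dif_pos hn

theorem letterVar_of_le {n : ℕ} (hn : 2 * N ≤ n) : letterVar N n = 0 := dif_neg (not_lt.2 hn)

theorem letterOf_lt {m n : ℕ} {hm : m < 2 * N} {hn : n < 2 * N} (h : m < n) :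
    letterOf m hm < letterOf n hn := by
  rw [← letterIdx_lt_iff, letterIdx_letterOf, letterIdx_letterOf]; exact h

theorem barred_letterOf {n : ℕ} {hn : n < 2 * N} : Barred (letterOf n hn) ↔ Odd n := by
  rw [barred_iff, letterIdx_letterOf]

theorem kronLetters (N : ℕ) : KronLetters (letterVar N) where
  yyx {x y} hy hxy := by
    -- If the largest letter is out of range, it is zero and occurs in every term, so the relation
    -- is trivial; the same split serves all six relations.
    rcases lt_or_ge y (2 * N) with h | h
    · rw [letterVar_of_lt h, letterVar_of_lt (hxy.trans h)]
      simpa using toUKron_rel (.yyx (by rwa [barred_letterOf, Nat.not_odd_iff_even])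
        (letterOf_lt hxy))
    · simp [letterVar_of_le h]
  zyy {y z} hy hyz := by
    rcases lt_or_ge z (2 * N) with h | h
    · rw [letterVar_of_lt h, letterVar_of_lt (hyz.trans h)]
      simpa using toUKron_rel (.zyy (by rwa [barred_letterOf, Nat.not_odd_iff_even])
        (letterOf_lt hyz))
    · simp [letterVar_of_le h]
  yyz {y z} hy hyz := by
    rcases lt_or_ge z (2 * N) with h | h
    · rw [letterVar_of_lt h, letterVar_of_lt (hyz.trans h)]
      simpa using toUKron_rel (.yyz (by rwa [barred_letterOf]) (letterOf_lt hyz))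
    · simp [letterVar_of_le h]
  xyy {x y} hy hxy := by
    rcases lt_or_ge y (2 * N) with h | h
    · rw [letterVar_of_lt h, letterVar_of_lt (hxy.trans h)]
      simpa using toUKron_rel (.xyy (by rwa [barred_letterOf]) (letterOf_lt hxy))
    · simp [letterVar_of_le h]
  rotate x := by
    rcases lt_or_ge (x + 2) (2 * N) with h | h
    · rw [letterVar_of_lt h, letterVar_of_lt (show x + 1 < 2 * N by lia),
        letterVar_of_lt (show x < 2 * N by lia)]
      simpa using toUKron_rel (.rotate (down_letterOf (by lia)) (downTwo_letterOf h))
    · simp [letterVar_of_le h]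
  far {x z} hxz := by
    rcases lt_or_ge z (2 * N) with h | h
    · obtain ⟨w, rfl⟩ : ∃ w, z = w + 2 := ⟨z - 2, by lia⟩
      rw [letterVar_of_lt h, letterVar_of_lt (show x < 2 * N by lia)]
      simpa using toUKron_rel (.far (downTwo_letterOf h) (letterOf_lt (by lia)))
    · simp [letterVar_of_le h]

end Letters

/-! ### Elementary functions as sums over words -/

section ElementaryWords

variable {N : ℕ}

instance : IsTrans (Letter N) ColGE where
  trans := by
    rintro a b c (h1 | ⟨rfl, h1⟩) (h2 | ⟨rfl, h2⟩)
    · exact Or.inl (h2.trans h1)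
    · exact Or.inl h1
    · exact Or.inl h2
    · exact Or.inr ⟨rfl, h1⟩

/-- The words of the elementary symmetric function in the letters below position `n`. -/
def IsElemWord (n : ℕ) (L : List (Letter N)) : Prop :=
  L.IsChain ColGE ∧ ∀ x ∈ L, letterIdx x < n

theorem isElemWord_cons_self {n : ℕ} {a : Letter N} (ha : letterIdx a = n) (L : List (Letter N)) :
    IsElemWord (n + 1) (a :: L) ↔ IsElemWord (if Odd n then n + 1 else n) L := by
  rw [IsElemWord, IsElemWord, List.isChain_iff_pairwise, List.isChain_iff_pairwise,
    List.pairwise_cons]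
  have key (b : Letter N) : ColGE a b ↔ letterIdx b < if Odd n then n + 1 else n := by
    rw [ColGE, ← letterIdx_lt_iff, ← letterIdx_injective.eq_iff, barred_iff, ha]
    split_ifs with h
    · simp only [h, and_true]; lia
    · simp [h]
  constructor
  · rintro ⟨⟨h1, h2⟩, -⟩
    exact ⟨h2, fun b hb => (key b).1 (h1 b hb)⟩
  · rintro ⟨h1, h2⟩
    refine ⟨⟨fun b hb => (key b).2 (h2 b hb), h1⟩, fun b hb => ?_⟩
    rcases List.mem_cons.1 hb with rfl | hb
    · lia
    · have := h2 b hb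
      split_ifs at this <;> lia

theorem isElemWord_cons_ne {n : ℕ} {a : Letter N} (ha : letterIdx a ≠ n) (L : List (Letter N)) :
    IsElemWord (n + 1) (a :: L) ↔ IsElemWord n (a :: L) := by
  rw [IsElemWord, IsElemWord, List.isChain_iff_pairwise, List.pairwise_cons]
  refine and_congr_right fun h => ⟨fun h2 b hb => ?_, fun h2 b hb => (h2 b hb).trans (by lia)⟩
  have h3 := h2 a (by simp)
  rcases List.mem_cons.1 hb with rfl | hb
  · lia
  · rcases h.1 b hb with h4 | ⟨rfl, -⟩
    · rw [← letterIdx_lt_iff] at h4; lia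
    · lia

-- Sort the words by whether the first letter, which is the largest, has position `n`. If so, the
-- rest may use `n` again exactly when `n` is barred; this is the recursion of `elemNat`.
open Classical in
theorem sum_elemWords (n k : ℕ) (hn : n ≤ 2 * N) :
    ∑ z : Fin k → Letter N with IsElemWord n (List.ofFn z),
      ((List.ofFn z).map fun x => letterVar N (letterIdx x)).prod =
        elemNat (letterVar N) n k := by
  induction n, k using elemNat.induct with
  | case1 => simp [elemNat, IsElemWord]
  | case2 k =>
    rw [elemNat]
    refine Finset.sum_eq_zero fun z hz => ?_
    have := (Finset.mem_filter.1 hz).2.2 (z 0) (by simp)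
    lia
  | case3 n => simp [elemNat, IsElemWord]
  | case4 n k ih1 ih2 ih3 =>
    have ih : ∑ z : Fin k → Letter N with IsElemWord (if Odd n then n + 1 else n) (List.ofFn z),
        ((List.ofFn z).map fun x => letterVar N (letterIdx x)).prod =
          if Odd n then elemNat (letterVar N) (n + 1) k else elemNat (letterVar N) n k := by
      by_cases hodd : Odd n
      · simpa only [if_pos hodd] using ih2 hn
      · simpa only [if_neg hodd] using ih3 (by lia)
    rw [elemNat, ← ih, ← ih1 (by lia), ← Finset.sum_filter_add_sum_filter_not _
      (fun z : Fin (k + 1) → Letter N => letterIdx (z 0) ≠ n), Finset.mul_sum]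
    congr 1
    · refine Finset.sum_congr ?_ fun _ _ => rfl
      ext z
      simp only [Finset.mem_filter, Finset.mem_univ, true_and, List.ofFn_succ]
      constructor
      · rintro ⟨h1, h2⟩
        exact (isElemWord_cons_ne h2 _).1 h1
      · intro h1
        have h2 : letterIdx (z 0) ≠ n := (h1.2 (z 0) (by simp)).ne
        exact ⟨(isElemWord_cons_ne h2 _).2 h1, h2⟩
    · refine Finset.sum_nbij' Fin.tail (fun z => Fin.cons (letterOf n (by lia)) z) ?_ ?_ ?_ ?_ ?_
      · intro z hz
        simp only [Finset.mem_filter, Finset.mem_univ, true_and, List.ofFn_succ, not_not] at hz ⊢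
        exact (isElemWord_cons_self hz.2 _).1 hz.1
      · intro z hz
        simp only [Finset.mem_filter, Finset.mem_univ, true_and, List.ofFn_succ, not_not,
          Fin.cons_zero, Fin.cons_succ, letterIdx_letterOf, and_true] at hz ⊢
        exact (isElemWord_cons_self (letterIdx_letterOf _ _) _).2 hz
      · intro z hz
        simp only [Finset.mem_filter, Finset.mem_univ, true_and, not_not] at hz
        conv_rhs => rw [← Fin.cons_self_tail z]
        congr 1
        exact letterIdx_injective (by rw [letterIdx_letterOf, hz.2])
      · intro z _
        simp
      · intro z hz
        simp only [Finset.mem_filter, Finset.mem_univ, true_and, not_not] at hz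
        rw [List.ofFn_succ, List.map_cons, List.prod_cons, hz.2]
        rfl

theorem toUKron_monomial (w : List (Letter N)) :
    toUKron N (monomial w) = (w.map fun x => letterVar N (letterIdx x)).prod := by
  rw [monomial, map_list_prod, List.map_map]
  congr 1
  exact List.map_congr_left fun x _ => (letterVar_letterIdx x).symm

theorem toUKron_elem (k : ℤ) :
    toUKron N (elem N k) = elemBelow (letterVar N) (2 * N) k := by
  rcases k with k | k
  · rw [elem, elemBelow, if_pos (show 0 ≤ Int.ofNat k from Int.natCast_nonneg k), map_sum]
    simp only [toUKron_monomial]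
    change _ = elemNat (letterVar N) (2 * N) k
    rw [← sum_elemWords _ _ le_rfl]
    refine Finset.sum_congr ?_ fun _ _ => rfl
    ext z
    simp [IsElemWord, letterIdx_lt]
  · rw [elem, elemBelow_of_neg _ _ (Int.negSucc_lt_zero k), map_zero]

theorem toUKron_superSchur (ν : YoungDiagram) : toUKron N (superSchur N ν) =
    ∑ π : Equiv.Perm (Fin (ν.rowLen 0)), (Equiv.Perm.sign π : ℤ) •
      (List.ofFn fun i : Fin (ν.rowLen 0) => elemBelow (letterVar N) (2 * N)
        ((ν.colLen i : ℤ) - (i : ℕ) + ((π i : ℕ) : ℤ))).prod := by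
  rw [superSchur, map_sum]
  refine Finset.sum_congr rfl fun π _ => ?_
  rw [map_zsmul, map_list_prod, List.map_ofFn]
  congr 3
  funext i
  rw [Function.comp_apply, toUKron_elem, sub_add_eq_add_sub]

end ElementaryWords

/-! ### Diagonal reading words -/

section Sqread

variable {N : ℕ} {ν : YoungDiagram}

theorem filterMap_range_of_le {α : Type*} {f : ℕ → Option α} {a b : ℕ} (hab : a ≤ b)
    (hf : ∀ i, a ≤ i → f i = none) : (List.range b).filterMap f = (List.range a).filterMap f := by
  induction b, hab using Nat.le_induction with
  | base => rfl
  | succ b hab ih => rw [List.range_succ, List.filterMap_append, ih]; simp [hf b hab]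

theorem filterMap_range_add {α : Type*} {f : ℕ → Option α} (s n : ℕ)
    (hf : ∀ i, i < s → f i = none) :
    (List.range (s + n)).filterMap f = (List.range n).filterMap fun i => f (s + i) := by
  rw [List.range_add, List.filterMap_append, List.filterMap_map, List.filterMap_eq_nil_iff.2]
  · rfl
  · intro i hi
    exact hf i (List.mem_range.1 hi)

/-- A diagonal can be indexed by its rows or by its columns. -/
theorem filterMap_diagonal {α : Type*} (g : ℕ → ℕ → Option α) (r l k : ℕ)
    (hg : ∀ i c, r ≤ i ∨ l ≤ c → g i c = none) :
    ((List.range r).filterMap fun i => if r ≤ i + k then g i (i + k - r) else none) =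
      (List.range l).filterMap fun c => if k ≤ c + r then g (c + r - k) c else none := by
  -- The diagonal starts in column 0 and row `r - k` in the first case, in row 0 and column `k - r`
  -- in the second.
  rcases le_total k r with hk | hk
  · obtain ⟨s, rfl⟩ := Nat.exists_eq_add_of_le' hk
    rw [filterMap_range_add s k fun i hi => if_neg (by lia)]
    have h1 (c : ℕ) : (if s + k ≤ s + c + k then g (s + c) (s + c + k - (s + k)) else none) =
        g (s + c) c := by
      rw [if_pos (by lia)]; congr 1; lia
    have h2 (c : ℕ) : (if k ≤ c + (s + k) then g (c + (s + k) - k) c else none) =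
        g (s + c) c := by
      rw [if_pos (by lia)]; congr 1; lia
    simp only [h1, h2]
    rw [← filterMap_range_of_le (le_max_left k l) fun c hc => hg _ _ (Or.inl (by lia)),
      ← filterMap_range_of_le (le_max_right k l) fun c hc => hg _ _ (Or.inr hc)]
  · obtain ⟨s, rfl⟩ := Nat.exists_eq_add_of_le' hk
    rw [← filterMap_range_of_le (le_max_left l (s + r)) fun c hc => by
      rw [hg _ _ (Or.inr hc), ite_self],
      filterMap_range_of_le (le_max_right l (s + r)) fun c hc => by
        rw [hg _ _ (Or.inl (by lia)), ite_self],
      filterMap_range_add s r fun i hi => if_neg (by lia)]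
    refine List.filterMap_congr fun i _ => ?_
    rw [if_pos (by lia), if_pos (by lia)]
    congr 1 <;> lia

theorem diagonal_map_letterIdx (T : ν.cells → Letter N) (k : ℕ) :
    (diagonal T ((k : ℤ) - ν.colLen 0)).map letterIdx =
      diagFrom ν.colLen (ν.colLen 0) (ν.rowLen 0) (entries fun x => letterIdx (T x)) k 0 := by
  have key := filterMap_diagonal
    (fun i c => if (i, c) ∈ ν.cells then some (entries (fun x => letterIdx (T x)) i c) else none)
    (ν.colLen 0) (ν.rowLen 0) k fun i c hic => if_neg fun hmem => by
      rw [mem_cells_iff] at hmem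
      have h1 := lt_rowLen_of_lt_colLen hmem
      have h2 := colLen_le (ν := ν) c
      lia
  rw [diagFrom, diagonal, List.map_filterMap, Nat.sub_zero, ← List.range_eq_range']
  refine Eq.trans (List.filterMap_congr fun i _ => ?_) (key.trans (List.filterMap_congr
    fun c _ => ?_))
  · by_cases h1 : ν.colLen 0 ≤ i + k
    · have h2 : ((i : ℤ) + ((k : ℤ) - ν.colLen 0)).toNat = i + k - ν.colLen 0 := by lia
      have h3 : 0 ≤ (i : ℤ) + ((k : ℤ) - ν.colLen 0) := by lia
      rw [if_pos h1]
      by_cases h4 : (i, i + k - ν.colLen 0) ∈ ν.cells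
      · rw [dif_pos ⟨h3, by rwa [h2]⟩, if_pos h4, entries, dif_pos h4]
        simp only [h2, Option.map_some]
      · rw [dif_neg (by rw [h2]; exact fun h => h4 h.2), if_neg h4]
        rfl
    · rw [if_neg h1, dif_neg (by lia)]
      rfl
  · simp only [mem_cells_iff]
    split_ifs <;> first | rfl | lia

theorem toUKron_diagonalWord (T : ν.cells → Letter N) (k : ℕ) :
    toUKron N (monomial (diagonalWord T ((k : ℤ) - ν.colLen 0))) =
      unbarredWord (letterVar N) (diagFrom ν.colLen (ν.colLen 0) (ν.rowLen 0)
        (entries fun x => letterIdx (T x)) k 0) *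
      barredWord (letterVar N) (diagFrom ν.colLen (ν.colLen 0) (ν.rowLen 0)
        (entries fun x => letterIdx (T x)) k 0) := by
  rw [← diagonal_map_letterIdx, toUKron_monomial, diagonalWord, List.map_append, List.prod_append,
    unbarredWord, barredWord, List.filter_map, List.filter_map, ← List.map_reverse, List.map_map,
    List.map_map]
  simp only [barred_iff]
  rfl

theorem toUKron_sqread (T : ν.cells → Letter N) : toUKron N (monomial (sqread T)) =
    wordsBelow (letterVar N) ν.colLen (ν.colLen 0) (ν.rowLen 0)
      (entries fun x => letterIdx (T x)) (ν.colLen 0 + ν.rowLen 0) := by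
  have happend (L : List ℕ) (f : ℕ → List (Letter N)) : toUKron N (monomial (L.flatMap f)) =
      (L.map fun k => toUKron N (monomial (f k))).prod := by
    induction L with
    | nil => simp [monomial]
    | cons a L ih =>
      rw [List.flatMap_cons, List.map_cons, List.prod_cons, ← ih, ← map_mul]
      simp [monomial]
  -- The range in `sqread` is cast to integers by a monadic coercion; unfolding it leaves a
  -- `flatMap` over natural numbers.
  rw [sqread, List.bind_eq_flatMap, List.flatMap_assoc]
  simp only [List.pure_def, List.flatMap_cons, List.flatMap_nil, List.append_nil]
  rw [happend, wordsBelow]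
  simp only [toUKron_diagonalWord]

end Sqread

/-! ### Locally compatible fillings are colored tableaux -/

section Tableaux

variable {N : ℕ} {ν : YoungDiagram}

/-- Neighbour conditions chain along a row because all boxes between two boxes of a Young diagram
belong to it. -/
theorem row_le_of_entryOK {T : ν.cells → ℕ} (hT : ∀ x, EntryOK N T x) (i c n : ℕ)
    (h : (i, c + n + 1) ∈ ν.cells) : 2 * ((entries T i c + 1) / 2) ≤ entries T i (c + n + 1) := by
  induction n with
  | zero =>
    have h1 := (hT ⟨_, h⟩).2 (Nat.succ_pos _)
    have h2 : i < ν.colLen c :=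
      (mem_cells_iff.1 h).trans_le (colLen_antitone (show c ≤ c + 0 + 1 by lia))
    simp only [Nat.add_sub_cancel, Nat.add_zero] at h1
    rwa [flag, if_pos h2] at h1
  | succ n ih =>
    have h2 : i < ν.colLen (c + n + 1) :=
      (mem_cells_iff.1 h).trans_le (colLen_antitone (show c + n + 1 ≤ c + (n + 1) + 1 by lia))
    have h3 := ih (mem_cells_iff.2 h2)
    have h1 := (hT ⟨_, h⟩).2 (Nat.succ_pos _)
    simp only [Nat.add_sub_cancel, ← Nat.add_assoc] at h1 ⊢
    rw [flag, if_pos h2] at h1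
    lia

theorem col_lt_of_entryOK {T : ν.cells → ℕ} (hT : ∀ x, EntryOK N T x) (i c n : ℕ)
    (h : (i + n + 1, c) ∈ ν.cells) :
    entries T i c < 2 * ((entries T (i + n + 1) c + 1) / 2) := by
  rw [mem_cells_iff] at h
  induction n with
  | zero =>
    have h1 := (hT ⟨(i, c), mem_cells_iff.2 (by lia)⟩).1
    rw [flag, if_pos h] at h1
    exact h1
  | succ n ih =>
    have h3 := ih (by lia)
    have h1 := (hT ⟨(i + n + 1, c), mem_cells_iff.2 (by lia)⟩).1
    simp only [← Nat.add_assoc] at h1 h ⊢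
    rw [flag, if_pos h] at h1
    lia

/-- The number `2 * ((x + 1) / 2)` is `x` for even `x` and `x + 1` for odd `x`, so strictness is
imposed exactly after a barred letter. A larger letter of either kind is at least one position
higher. -/
theorem le_and_lt_iff_row {x y : Letter N} :
    (x ≤ y ∧ (Barred x → Barred y → x < y)) ↔ 2 * ((letterIdx x + 1) / 2) ≤ letterIdx y := by
  rw [barred_iff, barred_iff, ← letterIdx_lt_iff, ← letterIdx_le_iff, Nat.odd_iff, Nat.odd_iff]
  lia

theorem le_and_lt_iff_col {x y : Letter N} :
    (x ≤ y ∧ (¬ Barred x → ¬ Barred y → x < y)) ↔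
      letterIdx x < 2 * ((letterIdx y + 1) / 2) := by
  rw [barred_iff, barred_iff, ← letterIdx_lt_iff, ← letterIdx_le_iff, Nat.odd_iff, Nat.odd_iff]
  lia

theorem isColoredTableau_iff (T : ν.cells → Letter N) :
    IsColoredTableau T ↔ ∀ x, EntryOK N (fun x => letterIdx (T x)) x := by
  constructor
  · rintro ⟨h1, h2⟩ ⟨⟨i, c⟩, hx⟩
    refine ⟨?_, fun hc => ?_⟩
    · simp only
      rw [flag]
      split_ifs with hi
      · rw [entries, entries, dif_pos hx, dif_pos (mem_cells_iff.2 hi)]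
        exact le_and_lt_iff_col.1 (h2 _ _ rfl (Nat.lt_succ_self i))
      · rw [entries, dif_pos hx]
        exact letterIdx_lt _
    · have hi : i < ν.colLen (c - 1) :=
        (mem_cells_iff.1 hx).trans_le (colLen_antitone (Nat.sub_le c 1))
      simp only
      rw [flag, if_pos hi, entries, entries, dif_pos hx, dif_pos (mem_cells_iff.2 hi)]
      exact le_and_lt_iff_row.1 (h1 _ _ rfl (Nat.sub_lt hc one_pos))
  · intro hT
    refine ⟨?_, ?_⟩
    · rintro ⟨⟨i, c⟩, hx⟩ ⟨⟨i', c'⟩, hy⟩ rfl hlt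
      obtain ⟨n, rfl⟩ := Nat.exists_eq_add_of_lt hlt
      have := row_le_of_entryOK hT i c n hy
      rw [entries, entries, dif_pos hx, dif_pos hy] at this
      exact le_and_lt_iff_row.2 this
    · rintro ⟨⟨i, c⟩, hx⟩ ⟨⟨i', c'⟩, hy⟩ rfl hlt
      obtain ⟨n, rfl⟩ := Nat.exists_eq_add_of_lt hlt
      have := col_lt_of_entryOK hT i c n hy
      rw [entries, entries, dif_pos hx, dif_pos hy] at this
      exact le_and_lt_iff_col.2 this

theorem sum_fillings_eq_sum_tableaux {A : Type*} [AddCommMonoid A] (G : (ν.cells → ℕ) → A) :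
    ∑ T ∈ fillings (2 * N) (EntryOK N) (fun _ : ν.cells => False) 0, G T =
      ∑ T : ColoredTableau N ν, G fun x => letterIdx (T.1 x) := by
  symm
  refine Finset.sum_nbij (fun T x => letterIdx (T.1 x)) ?_ ?_ ?_ fun _ _ => rfl
  · intro T _
    rw [mem_fillings]
    exact ⟨fun _ => False.elim, fun x _ =>
      ⟨letterIdx_lt _, (isColoredTableau_iff T.1).1 T.2 x⟩⟩
  · intro T _ T' _ h
    exact Subtype.ext (funext fun x => letterIdx_injective (congrFun h x))
  · intro T hT
    have hT := (mem_fillings.1 hT).2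
    have hT' : (fun x => letterIdx (letterOf (T x) (hT x not_false).1)) = T :=
      funext fun x => letterIdx_letterOf _ _
    refine ⟨⟨fun x => letterOf (T x) (hT x not_false).1, ?_⟩, by simp, hT'⟩
    rw [isColoredTableau_iff, hT']
    exact fun x => (hT x not_false).2

end Tableaux

end SuperSchur

theorem theorem2p2 (N : ℕ) (ν : YoungDiagram) :
    SuperSchur.toUKron N (SuperSchur.superSchur N ν) =
      ∑ T : SuperSchur.ColoredTableau N ν,
        SuperSchur.toUKron N (SuperSchur.monomial (SuperSchur.sqread T.1)) := by
  simp only [SuperSchur.toUKron_sqread]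
  rw [SuperSchur.toUKron_superSchur, SuperSchur.det_elemBelow_eq_sum (SuperSchur.kronLetters N),
    SuperSchur.sum_fillings_eq_sum_tableaux]
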